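/- Let $d\in\mathbb N$, $\xi>0$, and let $G_\xi(dm)=\xi m^{-\xi-1}\,dm$ on $(0,\infty)$. Let $h:\mathbb R^d\to[0,+\infty]$ be continuous with $$\int_{\mathbb R^d}h(x)^\xi\,dx=1\quad\text{and}\quad \int_{\mathbb R^d}h^+(x)^\xi\,dx<\infty,\qquad h^+(x)=\sup_{|z|\le 1}h(x+z).$$ Let $\Phi_\infty$ be a Poisson point process on $\mathbb R^d\times(0,\infty)$ with intensity measure $dx\,G_\xi(dm)$, defined on a probability space $(\Omega,\mathcal F,\mathbb P)$. For a point $\phi=(x_\phi,m_\phi)$ put $h_\phi(y)=m_\phi h(y-x_\phi)$, and let $M_\infty(y)=\sup\{h_\phi(y):\phi\in\Phi_\infty\}$, $y\in\mathbb R^d$. A point $\phi\in\Phi_\infty$ is called extremal if $M_\infty(y)=h_\phi(y)$ for some $y\in\mathbb R^d$; let $\tilde\Phi_\infty\subset\Phi_\infty$ be the set of extremal points. Then $\tilde\Phi_\infty$ is (up to $\mathbb P$-null sets) a stationary marked point process on $\mathbb R^d\times(0,\infty)$: it is a random locally finite subset, almost surely only finitely many of its points have their location in any given bounded subset of $\mathbb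 R^d$, and for all $z\in\mathbb R^d$ the translate $\{(x+z,m):(x,m)\in\tilde\Phi_\infty\}$ has the same law as $\tilde\Phi_\infty$. Moreover $$\tilde\lambda=\int_0^\infty\bigl(1-\mathbb P(M_\infty\ge mh)\bigr)\,G_\xi(dm)$$ satisfies $0<\tilde\lambda<\infty$, where $M_\infty\ge mh$ means $M_\infty(y)\ge m h(y)$ for all $y\in\mathbb R^d$; $$\nu(dm)=\tilde\lambda^{-1}\bigl(1-\mathbb P(M_\infty\ge mh)\bigr)\,G_\xi(dm)$$ is a probability measure on $(0,\infty)$; and the Campbell measure $C(A)=\mathbb E\bigl[\#(\tilde\Phi_\infty\cap A)\bigr]$ of $\tilde\Phi_\infty$ is $$C(dx,dm)=\tilde\lambda\,dx\,\nu(dm).$$ That is, $\tilde\Phi_\infty$ has intensity $\tilde\lambda$ and Palm mark distribution $\nu$. -/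

import Mathlib

open MeasureTheory ProbabilityTheory
open scoped ENNReal

noncomputable section

namespace ExtremalShotNoise

/-- The locally finite subsets of a topological space: each compact set contains only finitely
many of their points. -/
def Config (X : Type*) [TopologicalSpace X] : Type _ :=
  {s : Set X // ∀ K : Set X, IsCompact K → (s ∩ K).Finite}

namespace Config

variable {X : Type*} [TopologicalSpace X]

/-- The number of points of the configuration `s` in the set `A`. -/
def count (A : Set X) (s : Config X) : ℕ∞ := (s.1 ∩ A).encard

/-- The σ-field on configurations generated by the counts of the points in Borel sets. -/
instance [MeasurableSpace X] : MeasurableSpace (Config X) :=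
  ⨆ (A : Set X) (_ : MeasurableSet A), MeasurableSpace.comap (count A) inferInstance

end Config

/-- The space `ℝ^d`. -/
abbrev Loc (d : ℕ) : Type := EuclideanSpace ℝ (Fin d)

/-- The space of marks `(0, ∞)`. -/
abbrev Mark : Type := Set.Ioi (0 : ℝ)

/-- The translate `{(x + z, m) : (x, m) ∈ s}` of a configuration of marked points. -/
def Config.translate {d : ℕ} (z : Loc d) (s : Config (Loc d × Mark)) : Config (Loc d × Mark) :=
  ⟨(fun φ : Loc d × Mark => (φ.1 + z, φ.2)) '' s.1, by
    intro K hK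
    have hc : Continuous (fun φ : Loc d × Mark => (φ.1 - z, φ.2)) := by fun_prop
    refine ((s.2 _ (hK.image hc)).image (fun φ : Loc d × Mark => (φ.1 + z, φ.2))).subset ?_
    rintro _ ⟨⟨φ, hφ, rfl⟩, hφK⟩
    exact ⟨φ, ⟨hφ, ⟨_, hφK, by simp⟩⟩, rfl⟩⟩

/-- `Φ` is a Poisson point process on `X` with intensity measure `μ`. -/
structure IsPoissonPointProcess {Ω X : Type*} [MeasurableSpace Ω] [TopologicalSpace X]
    [MeasurableSpace X] (P : Measure Ω) (μ : Measure X) (Φ : Ω → Config X) : Prop where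
  measurable : Measurable Φ
  poisson : ∀ A : Set X, MeasurableSet A → μ A ≠ ∞ →
    P.map (fun ω => (Φ ω).count A) =
      (poissonMeasure (μ A).toNNReal).map (fun k : ℕ => (k : ℕ∞))
  indep : ∀ (n : ℕ) (A : Fin n → Set X), (∀ i, MeasurableSet (A i)) →
    Pairwise (Function.onFun Disjoint A) → iIndepFun (fun i ω => (Φ ω).count (A i)) P

/-- `Ψ` is a stationary marked point process with locations in `ℝ^d` and marks in `(0, ∞)`:
a random configuration, with almost surely finitely many points (whatever their marks) above each
bounded set of locations, whose law is invariant under translations of the locations. -/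
structure IsStationaryMarkedPointProcess {Ω : Type*} [MeasurableSpace Ω] {d : ℕ}
    (P : Measure Ω) (Ψ : Ω → Config (Loc d × Mark)) : Prop where
  aemeasurable : AEMeasurable Ψ P
  ground_locallyFinite : ∀ᵐ ω ∂P, ∀ B : Set (Loc d), Bornology.IsBounded B →
    ((Ψ ω).1 ∩ B ×ˢ Set.univ).Finite
  stationary : ∀ z : Loc d, IdentDistrib (fun ω => (Ψ ω).translate z) Ψ P P

/-- The Campbell measure `C(A) = 𝔼[#{φ ∈ Ψ : φ ∈ A}]`, as a function of the set `A`. -/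
def campbell {Ω X : Type*} [MeasurableSpace Ω] [TopologicalSpace X]
    (P : Measure Ω) (Ψ : Ω → Config X) (A : Set X) : ℝ≥0∞ :=
  ∫⁻ ω, ((Ψ ω).count A : ℝ≥0∞) ∂P

/-- The measure `G_ξ(dm) = ξ m^(-ξ-1) dm` on `(0, ∞)`. -/
def Gξ (ξ : ℝ) : Measure Mark :=
  ((volume : Measure ℝ).comap ((↑) : Mark → ℝ)).withDensity fun m =>
    ENNReal.ofReal (ξ * (m : ℝ) ^ (-ξ - 1))

variable {d : ℕ}

/-- `h⁺(x) = sup {h(x + z) : |z| ≤ 1}`. -/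
def hPlus (h : Loc d → ℝ≥0∞) (x : Loc d) : ℝ≥0∞ := ⨆ (z : Loc d) (_ : ‖z‖ ≤ 1), h (x + z)

/-- `h_φ(y) = m h(y - x)` for the marked point `φ = (x, m)`. -/
def shot (h : Loc d → ℝ≥0∞) (φ : Loc d × Mark) (y : Loc d) : ℝ≥0∞ :=
  ENNReal.ofReal (φ.2 : ℝ) * h (y - φ.1)

/-- The extremal shot noise `M(y) = sup {h_φ(y) : φ ∈ s}`. -/
def shotNoise (h : Loc d → ℝ≥0∞) (s : Config (Loc d × Mark)) (y : Loc d) : ℝ≥0∞ :=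
  ⨆ φ ∈ s.1, shot h φ y

/-- The extremal points of `s`: those whose function attains the extremal shot noise somewhere. -/
def extremal (h : Loc d → ℝ≥0∞) (s : Config (Loc d × Mark)) : Config (Loc d × Mark) :=
  ⟨{φ ∈ s.1 | ∃ y, shotNoise h s y = shot h φ y}, fun K hK =>
    (s.2 K hK).subset fun _ hφ => ⟨hφ.1.1, hφ.2⟩⟩

variable {Ω : Type*} [MeasurableSpace Ω]

/-- `1 - ℙ(M ≥ m h)`, where `M ≥ m h` means that `M(y) ≥ m h(y)` for all `y`. -/
def exceedProb (P : Measure Ω) (h : Loc d → ℝ≥0∞) (Φ : Ω → Config (Loc d × Mark)) (m : Mark) :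
    ℝ≥0∞ :=
  1 - P {ω | ∀ y, ENNReal.ofReal (m : ℝ) * h y ≤ shotNoise h (Φ ω) y}

/-- `∫ (1 - ℙ(M ≥ m h)) G_ξ(dm)`. -/
def extremalIntensity (P : Measure Ω) (ξ : ℝ) (h : Loc d → ℝ≥0∞)
    (Φ : Ω → Config (Loc d × Mark)) : ℝ≥0∞ :=
  ∫⁻ m, exceedProb P h Φ m ∂(Gξ ξ)

/-- `ν(dm) = (∫ (1 - ℙ(M ≥ m' h)) G_ξ(dm'))⁻¹ (1 - ℙ(M ≥ m h)) G_ξ(dm)`. -/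
def extremalMarkLaw (P : Measure Ω) (ξ : ℝ) (h : Loc d → ℝ≥0∞)
    (Φ : Ω → Config (Loc d × Mark)) : Measure Mark :=
  (extremalIntensity P ξ h Φ)⁻¹ • (Gξ ξ).withDensity (exceedProb P h Φ)

end ExtremalShotNoise

end

/-! A point `φ` of `s` is extremal exactly when `h_φ` is, somewhere, at least the shot noise of the
other points `s.erase φ` (`Tame.erase_mem_touchSet`). So the Mecke equation
(`IsPoissonPointProcess.mecke`) turns the mean number of extremal points in `A` into the integral
over `φ ∈ A`, against `dx Gξ(dm)`, of the probability that `h_φ ≥ M` somewhere. For a fixed location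
and a realization with `M > 0`, the events `h_φ ≥ M` somewhere and `h_φ > M` somewhere differ for at
most one mark, and `Gξ` has no atoms; so the inequality may be made strict (`measure_touchSet`). By
translation invariance the strict event has probability `1 - ℙ(M ≥ m h)`, whatever the location
(`measure_exceedSet`). This is the Campbell formula.

The intensity is finite because an exceedance of `M` by `m h` at `y₀` forces cylinders over balls to
contain no high marks, for all `y` in a ball around `y₀`; the void probabilities are explicit
exponentials, and integrating them over `m` and `y` gives a multiple of `∫ (h⁺)^ξ`
(`extremalIntensity_lt_top`). A finite intensity yields local finiteness over bounded sets of
locations; stationarity is inherited from `Φ`, since `extremal` commutes with translations.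

Events that quantify over all `y` are made measurable by means of a dense sequence. This is
legitimate on tame configurations, where `M` is continuous; `∫ (h⁺)^ξ < ∞` makes `Φ` almost surely
tame. -/

set_option linter.unusedSectionVars false

noncomputable section

namespace ExtremalShotNoise

/-! ### Configurations: the point kernel, erasing a point, translations. -/

section

namespace Config

section Basic

variable {X : Type*} [TopologicalSpace X] [MeasurableSpace X]

lemma measurable_count {A : Set X} (hA : MeasurableSet A) :
    Measurable (count A : Config X → ℕ∞) := by
  exact Measurable.mono (comap_measurable (count A)) (le_iSup₂_of_le A hA le_rfl) le_rfl

lemma measurable_of_measurable_count {Y : Type*} [MeasurableSpace Y] {f : Y → Config X}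
    (hf : ∀ A, MeasurableSet A → Measurable fun y => (f y).count A) : Measurable f := by
  refine measurable_iff_comap_le.2 ?_
  simp only [instMeasurableSpace, MeasurableSpace.comap_iSup, MeasurableSpace.comap_comp, iSup_le_iff]
  exact fun A hA => (hf A hA).comap_le

variable [T2Space X] [SecondCountableTopology X] [SigmaCompactSpace X] [BorelSpace X]

lemma countable (s : Config X) : s.1.Countable := by
  rw [← Set.inter_univ s.1, ← iUnion_compactCovering X, Set.inter_iUnion]
  exact Set.countable_iUnion fun n => (s.2 _ (isCompact_compactCovering X n)).countable

lemma measurableSet (s : Config X) : MeasurableSet s.1 := s.countable.measurableSet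

lemma count_restrict_apply (s : Config X) {A : Set X} (hA : MeasurableSet A) :
    (Measure.count.restrict s.1) A = (s.count A : ℝ≥0∞) := by
  rw [Measure.restrict_apply hA, Measure.count_apply (hA.inter s.measurableSet), count,
    Set.inter_comm]

variable (X) in
/-- The counting measure of the points of a configuration, as a kernel. -/
def pointKernel : Kernel (Config X) X where
  toFun s := Measure.count.restrict s.1
  measurable' := by
    refine Measure.measurable_of_measurable_coe _ fun A hA => ?_
    simp_rw [count_restrict_apply _ hA]
    exact (measurable_of_countable _).comp (measurable_count hA)

lemma pointKernel_apply (s : Config X) {A : Set X} (hA : MeasurableSet A) :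
    pointKernel X s A = (s.count A : ℝ≥0∞) := count_restrict_apply s hA

lemma count_lt_top_of_subset_isCompact (s : Config X) {A K : Set X} (hK : IsCompact K)
    (hA : A ⊆ K) : s.count A < ⊤ :=
  Set.encard_lt_top_iff.2 ((s.2 K hK).subset (Set.inter_subset_inter_right _ hA))

/-- S-finiteness makes integrals against the points of a configuration measurable in the
configuration. Counts are finite on compact sets but not bounded uniformly in `s`; hence the
splitting both by disjoint relatively compact pieces and by the value `j` of the count there, which
bounds each part by `j`. -/
instance : IsSFiniteKernel (pointKernel X) := by
  classical
  let D : ℕ → Set X := disjointed (compactCovering X)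
  have hDm : ∀ n, MeasurableSet (D n) := fun n =>
    MeasurableSet.disjointed (fun k => (isCompact_compactCovering X k).measurableSet) n
  have hDK : ∀ n, D n ⊆ compactCovering X n := disjointed_subset _
  have hE : ∀ n j : ℕ, MeasurableSet {s : Config X | s.count (D n) = j} := fun n j =>
    measurable_count (hDm n) (measurableSet_singleton _)
  let κ : ℕ × ℕ → Kernel (Config X) X := fun p =>
    Kernel.piecewise (hE p.1 p.2) ((pointKernel X).restrict (hDm p.1)) 0
  have hκ : ∀ p, IsFiniteKernel (κ p) := fun p => by
    refine ⟨⟨p.2, ENNReal.natCast_lt_top _, fun s => ?_⟩⟩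
    simp only [κ, Kernel.piecewise_apply]
    split_ifs with hs
    · rw [Kernel.restrict_apply, Measure.restrict_apply MeasurableSet.univ, Set.univ_inter,
        pointKernel_apply _ (hDm _), show s.count (D p.1) = p.2 from hs]
      simp
    · simp
  have hsum : pointKernel X = Kernel.sum κ := by
    ext s A hA
    rw [Kernel.sum_apply' _ _ hA, ENNReal.tsum_prod']
    have h1 : ∀ n, ∑' j, κ (n, j) s A = pointKernel X s (A ∩ D n) := fun n => by
      obtain ⟨j, hj⟩ := ENat.ne_top_iff_exists.1
        (s.count_lt_top_of_subset_isCompact (isCompact_compactCovering X n) (hDK n)).ne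
      rw [tsum_eq_single j]
      · simp only [κ, Kernel.piecewise_apply]
        rw [if_pos (by exact hj.symm), Kernel.restrict_apply, Measure.restrict_apply hA]
      · intro i hi
        simp only [κ, Kernel.piecewise_apply]
        rw [if_neg]
        · simp
        · intro h'
          apply hi
          have := hj.trans h'
          exact_mod_cast this.symm
    simp_rw [h1]
    rw [← measure_iUnion _ fun n => hA.inter (hDm n), ← Set.inter_iUnion, iUnion_disjointed,
      iUnion_compactCovering, Set.inter_univ]
    intro i j hij
    exact (disjoint_disjointed _ hij).mono Set.inter_subset_right Set.inter_subset_right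
  rw [hsum]
  exact Kernel.isSFiniteKernel_sum

lemma ae_pointKernel (s : Config X) : ∀ᵐ x ∂(pointKernel X s), x ∈ s.1 :=
  ae_restrict_mem s.measurableSet

/-- Removal of a point from a configuration. -/
def erase (s : Config X) (x : X) : Config X :=
  ⟨s.1 \ {x}, fun K hK => (s.2 K hK).subset fun _ hy => ⟨hy.1.1, hy.2⟩⟩

lemma count_erase (s : Config X) (x : X) (A : Set X) (hx : x ∈ s.1) (hA : x ∈ A) :
    (s.erase x).count A = s.count A - 1 := by
  have : (s.erase x).1 ∩ A = (s.1 ∩ A) \ {x} := by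
    ext y; simp only [erase, Set.mem_inter_iff, Set.mem_sdiff]; tauto
  rw [count, this]
  exact Set.encard_sdiff_singleton_of_mem ⟨hx, hA⟩

lemma count_erase_of_notMem (s : Config X) (x : X) (A : Set X) (hx : x ∉ s.1 ∩ A) :
    (s.erase x).count A = s.count A := by
  have : (s.erase x).1 ∩ A = s.1 ∩ A := by
    ext y; simp only [erase, Set.mem_inter_iff, Set.mem_sdiff, Set.mem_singleton_iff]
    constructor
    · tauto
    · rintro ⟨h1, h2⟩
      exact ⟨⟨h1, fun h => hx (h ▸ ⟨h1, h2⟩)⟩, h2⟩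
  rw [count, this, count]

/-- Membership means that the point kernel charges the section at `p` of the diagonal, and the mass
of sections is measurable. -/
lemma measurableSet_mem : MeasurableSet {p : Config X × X | p.2 ∈ p.1.1} := by
  have h1 : Measurable fun p : Config X × X =>
      (Kernel.comap (pointKernel X) Prod.fst measurable_fst) p
        (Prod.mk p ⁻¹' {q : (Config X × X) × X | q.1.2 = q.2}) :=
    Kernel.measurable_kernel_prodMk_left (measurableSet_eq_fun (by fun_prop) (by fun_prop))
  convert h1 (measurableSet_singleton 0).compl using 1
  · ext p
    have : (Prod.mk p ⁻¹' {q : (Config X × X) × X | q.1.2 = q.2}) = {p.2} := by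
      ext y; simp [eq_comm]
    simp only [Set.mem_ofPred_eq, Set.mem_preimage, Set.mem_compl_iff, Set.mem_singleton_iff]
    rw [this, Kernel.comap_apply, pointKernel_apply _ (measurableSet_singleton _), count]
    simp

lemma measurable_erase : Measurable fun p : Config X × X => p.1.erase p.2 := by
  classical
  refine measurable_of_measurable_count fun A hA => ?_
  have : (fun p : Config X × X => (p.1.erase p.2).count A) = fun p =>
      if p.2 ∈ p.1.1 ∧ p.2 ∈ A then p.1.count A - 1 else p.1.count A := by
    funext p
    split_ifs with h
    · exact count_erase _ _ _ h.1 h.2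
    · exact count_erase_of_notMem _ _ _ h
  rw [this]
  have hc : Measurable fun p : Config X × X => p.1.count A :=
    (measurable_count hA).comp measurable_fst
  refine Measurable.ite ?_ ((measurable_of_countable fun k : ℕ∞ => k - 1).comp hc) hc
  exact measurableSet_mem.inter (measurable_snd hA)

lemma count_iUnion_of_finite {ι : Type*} [Fintype ι] (s : Config X) {A : ι → Set X}
    (hA : Pairwise (Function.onFun Disjoint A)) : s.count (⋃ i, A i) = ∑ i, s.count (A i) := by
  rw [count, Set.inter_iUnion, Set.encard_iUnion_of_finite, finsum_eq_sum_of_fintype]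
  · rfl
  · exact fun i j hij => (hA hij).mono Set.inter_subset_right Set.inter_subset_right

lemma count_iUnion_of_monotone (s : Config X) {A : ℕ → Set X} (hA : ∀ n, MeasurableSet (A n))
    (hmono : Monotone A) : (s.count (⋃ n, A n) : ℝ≥0∞) = ⨆ n, (s.count (A n) : ℝ≥0∞) := by
  simp_rw [← pointKernel_apply _ (MeasurableSet.iUnion hA), ← pointKernel_apply _ (hA _)]
  exact hmono.measure_iUnion

end Basic

lemma count_translate {d : ℕ} (z : Loc d) (s : Config (Loc d × Mark)) (A : Set (Loc d × Mark)) :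
    (s.translate z).count A = s.count ((fun φ : Loc d × Mark => (φ.1 + z, φ.2)) ⁻¹' A) := by
  have hinj : Function.Injective fun φ : Loc d × Mark => (φ.1 + z, φ.2) := by
    rintro ⟨a, b⟩ ⟨a', b'⟩ h
    simpa using h
  rw [count, count, ← hinj.encard_image (s.1 ∩ _), Set.image_inter_preimage]
  rfl

lemma measurable_translate {d : ℕ} (z : Loc d) :
    Measurable (translate z : Config (Loc d × Mark) → Config (Loc d × Mark)) := by
  refine measurable_of_measurable_count fun A hA => ?_
  simp_rw [count_translate]
  exact measurable_count ((by fun_prop : Measurable fun φ : Loc d × Mark => (φ.1 + z, φ.2)) hA)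

end Config

end

/-! ### Poisson distributions, atoms of finite families, and laws of random configurations. -/

section

lemma measurable_of_measurable_toENNReal {Y : Type*} [MeasurableSpace Y] {f : Y → ℕ∞}
    (hf : Measurable fun y => (f y : ℝ≥0∞)) : Measurable f := by
  refine measurable_to_countable' fun k => ?_
  have hk : f ⁻¹' {k} = (fun y => (f y : ℝ≥0∞)) ⁻¹' {(k : ℝ≥0∞)} := by
    ext y; simp
  rw [hk]
  exact hf (measurableSet_singleton _)

/-- The Poisson distribution on the extended natural numbers. -/
def poissonENat (r : ℝ≥0∞) : Measure ℕ∞ :=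
  (poissonMeasure r.toNNReal).map (fun k : ℕ => (k : ℕ∞))

instance (r : ℝ≥0∞) : IsProbabilityMeasure (poissonENat r) :=
  Measure.isProbabilityMeasure_map (measurable_of_countable _).aemeasurable

lemma lintegral_poissonENat (r : ℝ≥0∞) (F : ℕ∞ → ℝ≥0∞) :
    ∫⁻ k, F k ∂(poissonENat r) = ∑' k : ℕ, F k * poissonMeasure r.toNNReal {k} := by
  rw [poissonENat, lintegral_map (measurable_of_countable _) (measurable_of_countable _),
    lintegral_countable']

lemma poissonMeasure_succ (r : NNReal) (k : ℕ) :
    ((k + 1 : ℕ) : ℝ≥0∞) * poissonMeasure r {k + 1} = r * poissonMeasure r {k} := by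
  rw [poissonMeasure_singleton, poissonMeasure_singleton, ← ENNReal.ofReal_natCast,
    ← ENNReal.ofReal_coe_nnreal, ← ENNReal.ofReal_mul (by positivity),
    ← ENNReal.ofReal_mul (by positivity)]
  congr 1
  rw [Nat.factorial_succ]
  push_cast
  field_simp
  ring

/-- The size-bias identity that characterizes Poisson distributions. -/
lemma lintegral_mul_pred_poissonENat {r : ℝ≥0∞} (hr : r ≠ ∞) (F : ℕ∞ → ℝ≥0∞) :
    ∫⁻ k, (k : ℝ≥0∞) * F (k - 1) ∂(poissonENat r) = r * ∫⁻ k, F k ∂(poissonENat r) := by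
  rw [lintegral_poissonENat, lintegral_poissonENat, tsum_eq_zero_add' ENNReal.summable,
    ← ENNReal.tsum_mul_left]
  simp only [Nat.cast_zero, ENat.toENNReal_zero, zero_mul, zero_add]
  refine tsum_congr fun k => ?_
  have h1 : ((k + 1 : ℕ) : ℕ∞) - 1 = k := by
    have : ((k + 1 : ℕ) : ℕ∞) - ((1 : ℕ) : ℕ∞) = ((k + 1 - 1 : ℕ) : ℕ∞) := by norm_cast
    simpa using this
  rw [h1, ENat.toENNReal_coe, mul_right_comm, poissonMeasure_succ, ENNReal.coe_toNNReal hr]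
  ring

lemma poissonENat_zero (r : ℝ≥0∞) :
    poissonENat r {0} = ENNReal.ofReal (Real.exp (-r.toReal)) := by
  rw [poissonENat, Measure.map_apply (measurable_of_countable _) (measurableSet_singleton _)]
  have : (fun k : ℕ => (k : ℕ∞)) ⁻¹' {0} = {0} := by ext; simp
  rw [this, poissonMeasure_singleton]
  simp [ENNReal.coe_toNNReal_eq_toReal]

/-- Resampling one coordinate independently does not change a product law. This isolates the
coordinate to which the size-bias identity is applied. -/
lemma lintegral_pi_update {J : Type*} [Fintype J] [DecidableEq J] {Y : J → Type*}
    [∀ j, MeasurableSpace (Y j)] (p : ∀ j, Measure (Y j)) [∀ j, IsProbabilityMeasure (p j)]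
    (j : J) {f : (∀ j, Y j) → ℝ≥0∞} (hf : Measurable f) :
    ∫⁻ x, f x ∂Measure.pi p = ∫⁻ x, ∫⁻ k, f (Function.update x j k) ∂p j ∂Measure.pi p := by
  obtain ⟨x₀⟩ : Nonempty (∀ j, Y j) :=
    ⟨fun j => Classical.choice (nonempty_of_isProbabilityMeasure (p j))⟩
  have hg : Measurable (∫⋯∫⁻_{j}, f ∂p) := hf.lmarginal p
  have h1 : (∫⋯∫⁻_{j}, (∫⋯∫⁻_{j}, f ∂p) ∂p) = (∫⋯∫⁻_{j}, f ∂p) := by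
    simp only [lmarginal_singleton]
    funext x
    simp
  have h2 := lintegral_eq_lmarginal_univ (μ := p) (f := f) x₀
  have h3 := lintegral_eq_lmarginal_univ (μ := p) (f := ∫⋯∫⁻_{j}, f ∂p) x₀
  rw [lmarginal_erase' _ hf (Finset.mem_univ j), ← lmarginal_singleton] at h2
  rw [lmarginal_erase' _ hg (Finset.mem_univ j), ← lmarginal_singleton, h1, ← h2] at h3
  rw [← h3, lmarginal_singleton]

section Atoms

variable {X ι : Type*}

/-- The set of the points that belong to `B i` exactly for `i ∈ S`. -/
def atom (B : ι → Set X) (S : Finset ι) : Set X := {x | ∀ i, x ∈ B i ↔ i ∈ S}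

lemma disjoint_atom (B : ι → Set X) {S T : Finset ι} (h : S ≠ T) :
    Disjoint (atom B S) (atom B T) := by
  refine Set.disjoint_left.2 fun x hS hT => h ?_
  ext i
  rw [← hS i, hT i]

lemma measurableSet_atom [Finite ι] [MeasurableSpace X] {B : ι → Set X}
    (hB : ∀ i, MeasurableSet (B i)) (S : Finset ι) : MeasurableSet (atom B S) := by
  have : atom B S = ⋂ i, {x | x ∈ B i ↔ i ∈ S} := by ext; simp [atom]
  rw [this]
  exact MeasurableSet.iInter fun i => (hB i).iff (MeasurableSet.const _)

lemma iUnion_atom [Fintype ι] (B : ι → Set X) (i : ι) :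
    (⋃ S : {S : Finset ι // i ∈ S}, atom B S) = B i := by
  classical
  ext x
  simp only [Set.mem_iUnion, Subtype.exists, exists_prop]
  constructor
  · rintro ⟨S, hi, hx⟩
    exact (hx i).2 hi
  · intro hx
    exact ⟨Finset.univ.filter fun i => x ∈ B i, by simpa using hx, fun j => by simp⟩

end Atoms

variable {Ω X : Type*} [MeasurableSpace Ω] [TopologicalSpace X] [MeasurableSpace X]
  [T2Space X] [SecondCountableTopology X] [SigmaCompactSpace X] [BorelSpace X]

lemma Config.count_eq_sum_atom {ι : Type*} [Fintype ι] [DecidableEq ι] (B : ι → Set X) (i : ι) (s : Config X) :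
    s.count (B i) = ∑ S : {S : Finset ι // i ∈ S}, s.count (atom B S) := by
  rw [← Config.count_iUnion_of_finite, iUnion_atom]
  exact fun S T h => disjoint_atom B fun h' => h (Subtype.ext h')

lemma Config.measurable_of_measurable_count_of_ne_top (μ : Measure X) [SigmaFinite μ]
    {Y : Type*} [MeasurableSpace Y] {f : Y → Config X}
    (hf : ∀ B, MeasurableSet B → μ B ≠ ∞ → Measurable fun y => (f y).count B) : Measurable f := by
  refine measurable_of_measurable_count fun A hA => ?_
  have hm : ∀ n, Measurable fun y => (f y).count (A ∩ spanningSets μ n) := fun n =>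
    hf _ (hA.inter (measurableSet_spanningSets μ n))
      ((measure_mono Set.inter_subset_right).trans_lt (measure_spanningSets_lt_top μ n)).ne
  have hsup : (fun y => ((f y).count A : ℝ≥0∞)) =
      fun y => ⨆ n, ((f y).count (A ∩ spanningSets μ n) : ℝ≥0∞) := by
    funext y
    rw [← Config.count_iUnion_of_monotone, ← Set.inter_iUnion, iUnion_spanningSets,
      Set.inter_univ]
    · exact fun n => hA.inter (measurableSet_spanningSets μ n)
    · exact fun i j hij => Set.inter_subset_inter_right _ (monotone_spanningSets μ hij)
  have hA' : Measurable fun y => ((f y).count A : ℝ≥0∞) := by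
    rw [hsup]
    exact Measurable.iSup fun n => (measurable_of_countable _).comp (hm n)
  exact measurable_of_measurable_toENNReal hA'

/-- The counts of sets of finite measure generate the σ-field, so a law is determined by the joint
law of all these counts, which is in turn the unique projective limit of its finite-dimensional
marginals. -/
lemma Config.ext_of_map_count (μ : Measure X) [SigmaFinite μ] {L₁ L₂ : Measure (Config X)}
    [IsFiniteMeasure L₁]
    (h : ∀ I : Finset {B : Set X // MeasurableSet B ∧ μ B ≠ ∞},
      L₁.map (fun s (B : I) => s.count B.1.1) = L₂.map (fun s (B : I) => s.count B.1.1)) :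
    L₁ = L₂ := by
  let Ξ : Config X → ({B : Set X // MeasurableSet B ∧ μ B ≠ ∞} → ℕ∞) := fun s B => s.count B.1
  have hΞ : Measurable Ξ := measurable_pi_lambda _ fun B => measurable_count B.2.1
  -- Measurability of the identity out of the pulled-back σ-field says that every event is a
  -- preimage under `Ξ`.
  have hle : @Measurable _ _ (MeasurableSpace.comap Ξ inferInstance) _ (id : Config X → Config X) :=
    @Config.measurable_of_measurable_count_of_ne_top _ _ _ _ _ _ _ μ _ _
      (MeasurableSpace.comap Ξ inferInstance) _ fun B hB hμB =>
        (measurable_pi_apply (⟨B, hB, hμB⟩ : {B : Set X // MeasurableSet B ∧ μ B ≠ ∞})).comp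
          (comap_measurable Ξ)
  have hmap : L₁.map Ξ = L₂.map Ξ := by
    have hr : ∀ I : Finset {B : Set X // MeasurableSet B ∧ μ B ≠ ∞}, Measurable
        (I.restrict : ({B : Set X // MeasurableSet B ∧ μ B ≠ ∞} → ℕ∞) → (I → ℕ∞)) :=
      fun I => Finset.measurable_restrict I
    have : ∀ I : Finset {B : Set X // MeasurableSet B ∧ μ B ≠ ∞},
      IsFiniteMeasure (L₁.map (fun s (B : I) => s.count B.1.1)) := fun I => inferInstance
    refine IsProjectiveLimit.unique (P := fun I => L₁.map (fun s (B : I) => s.count B.1.1))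
      (fun I => ?_) (fun I => ?_)
    · rw [Measure.map_map (hr I) hΞ]; rfl
    · simp only [h I]
      rw [Measure.map_map (hr I) hΞ]; rfl
  ext E hE
  obtain ⟨F, hF, hFE⟩ := hle hE
  rw [Set.preimage_id] at hFE
  rw [← hFE, ← Measure.map_apply hΞ hF, hmap, Measure.map_apply hΞ hF]


/-! ### Uniqueness in law, the Mecke equation and void probabilities of Poisson processes. -/

namespace IsPoissonPointProcess

variable {P : Measure Ω} [IsProbabilityMeasure P] {μ : Measure X} {Φ : Ω → Config X}

lemma measurable_count (hΦ : IsPoissonPointProcess P μ Φ) {A : Set X} (hA : MeasurableSet A) :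
    Measurable fun ω => (Φ ω).count A :=
  (Config.measurable_count hA).comp hΦ.measurable

lemma map_count_of_disjoint (hΦ : IsPoissonPointProcess P μ Φ) {J : Type*} [Fintype J]
    {C : J → Set X} (hC : ∀ j, MeasurableSet (C j)) (hdisj : Pairwise (Function.onFun Disjoint C))
    (hfin : ∀ j, μ (C j) ≠ ∞) :
    P.map (fun ω j => (Φ ω).count (C j)) = Measure.pi fun j => poissonENat (μ (C j)) := by
  have e := Fintype.equivFin J
  have hind : iIndepFun (fun j ω => (Φ ω).count (C j)) P := by
    have h1 := hΦ.indep (Fintype.card J) (fun i => C (e.symm i)) (fun i => hC _)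
      (fun i j hij => hdisj fun h => hij (e.symm.injective h))
    have h2 := h1.precomp e.injective
    simpa using h2
  rw [(iIndepFun_iff_map_fun_eq_pi_map fun j => (hΦ.measurable_count (hC j)).aemeasurable).1 hind]
  congr 1
  funext j
  exact hΦ.poisson _ (hC j) (hfin j)

/-- The empty index set must be excluded: its atom is the complement of all the `B i`, which may
have infinite measure. -/
lemma measure_atom_ne_top {ι : Type*} {B : ι → Set X} (hfin : ∀ i, μ (B i) ≠ ∞)
    (S : {S : Finset ι // S.Nonempty}) : μ (atom B S) ≠ ∞ := by
  obtain ⟨i, hi⟩ := S.2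
  exact ((measure_mono fun x hx => (hx i).2 hi).trans_lt (hfin i).lt_top).ne

/-- The sums of the values `n S` over the sets `S` that contain a given element. -/
def atomSum (ι : Type*) [Fintype ι] [DecidableEq ι] (n : {S : Finset ι // S.Nonempty} → ℕ∞)
    (i : ι) : ℕ∞ :=
  ∑ S : {S : Finset ι // i ∈ S}, n ⟨S.1, ⟨i, S.2⟩⟩

lemma count_eq_atomSum {ι : Type*} [Fintype ι] [DecidableEq ι] (B : ι → Set X) (s : Config X) :
    (fun i => s.count (B i)) = atomSum ι fun S => s.count (atom B S) :=
  funext fun i => Config.count_eq_sum_atom B i s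

/-- Overlapping sets have dependent counts; they are sums of the independent Poisson counts of the
atoms. -/
lemma map_count (hΦ : IsPoissonPointProcess P μ Φ) {ι : Type*} [Fintype ι] [DecidableEq ι]
    {B : ι → Set X} (hB : ∀ i, MeasurableSet (B i)) (hfin : ∀ i, μ (B i) ≠ ∞) :
    P.map (fun ω i => (Φ ω).count (B i)) =
      (Measure.pi fun S : {S : Finset ι // S.Nonempty} => poissonENat (μ (atom B S))).map
        (atomSum ι) := by
  rw [← hΦ.map_count_of_disjoint (fun S => measurableSet_atom hB S.1)
    (fun S T h => disjoint_atom B fun h' => h (Subtype.ext h')) (measure_atom_ne_top hfin),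
    Measure.map_map (measurable_of_countable _)]
  · congr 1
    funext ω
    exact count_eq_atomSum B (Φ ω)
  · exact measurable_pi_lambda _ fun S => hΦ.measurable_count (measurableSet_atom hB S.1)

/-- The law of a Poisson point process is determined by its intensity measure. -/
lemma map_eq_map [SigmaFinite μ] (hΦ : IsPoissonPointProcess P μ Φ) {Ω' : Type*}
    [MeasurableSpace Ω'] {P' : Measure Ω'} [IsProbabilityMeasure P'] {Φ' : Ω' → Config X}
    (hΦ' : IsPoissonPointProcess P' μ Φ') : P.map Φ = P'.map Φ' := by
  classical
  have := Measure.isProbabilityMeasure_map (μ := P) hΦ.measurable.aemeasurable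
  refine Config.ext_of_map_count μ fun I => ?_
  have hm : Measurable fun (s : Config X) (B : I) => s.count B.1.1 :=
    measurable_pi_lambda _ fun B => Config.measurable_count B.1.2.1
  rw [Measure.map_map hm hΦ.measurable, Measure.map_map hm hΦ'.measurable]
  exact (hΦ.map_count (B := fun B : I => B.1.1) (fun B => B.1.2.1) fun B => B.1.2.2).trans
    (hΦ'.map_count (B := fun B : I => B.1.1) (fun B => B.1.2.1) fun B => B.1.2.2).symm

lemma lintegral_erase_of_disjoint (hΦ : IsPoissonPointProcess P μ Φ) {J : Type*} [Fintype J]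
    [DecidableEq J] {C : J → Set X} (hC : ∀ j, MeasurableSet (C j))
    (hdisj : Pairwise (Function.onFun Disjoint C)) (hfin : ∀ j, μ (C j) ≠ ∞) (j₀ : J)
    (F : (J → ℕ∞) → ℝ≥0∞) :
    ∫⁻ ω, (∫⁻ x in C j₀, F (fun j => ((Φ ω).erase x).count (C j))
        ∂(Config.pointKernel X (Φ ω))) ∂P =
      μ (C j₀) * ∫⁻ ω, F (fun j => (Φ ω).count (C j)) ∂P := by
  -- Erasing any point of `C j₀` lowers the coordinate `j₀` by one and leaves the others alone. The
  -- inner integral is thus the number of such points times one value of `F`, and the size-bias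
  -- identity in the coordinate `j₀` concludes.
  let F' : (J → ℕ∞) → ℝ≥0∞ := fun n => (n j₀ : ℝ≥0∞) * F (Function.update n j₀ (n j₀ - 1))
  have hvec : Measurable fun ω j => (Φ ω).count (C j) :=
    measurable_pi_lambda _ fun j => hΦ.measurable_count (hC j)
  have hin : ∀ s : Config X, ∫⁻ x in C j₀, F (fun j => (s.erase x).count (C j))
      ∂(Config.pointKernel X s) = F' fun j => s.count (C j) := by
    intro s
    have hae : ∀ᵐ x ∂((Config.pointKernel X s).restrict (C j₀)),
        F (fun j => (s.erase x).count (C j)) =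
          F (Function.update (fun j => s.count (C j)) j₀ (s.count (C j₀) - 1)) := by
      filter_upwards [ae_restrict_mem (hC j₀), ae_restrict_of_ae s.ae_pointKernel] with x hx hxs
      congr 1
      funext j
      by_cases hj : j = j₀
      · subst hj
        simp [Config.count_erase _ _ _ hxs hx]
      · rw [Function.update_of_ne hj, Config.count_erase_of_notMem]
        exact fun h => (Set.disjoint_left.1 (hdisj hj) h.2) hx
    rw [lintegral_congr_ae hae, lintegral_const, Measure.restrict_apply_univ,
      Config.pointKernel_apply _ (hC j₀), mul_comm]
  simp_rw [hin]
  have hlaw := hΦ.map_count_of_disjoint hC hdisj hfin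
  rw [← lintegral_map (f := F') (measurable_of_countable _) hvec,
    ← lintegral_map (f := F) (measurable_of_countable _) hvec, hlaw,
    lintegral_pi_update _ j₀ (measurable_of_countable F'),
    lintegral_pi_update _ j₀ (measurable_of_countable F),
    ← lintegral_const_mul _ (measurable_of_countable _)]
  congr 1
  funext n
  simp only [F', Function.update_self, Function.update_idem]
  exact lintegral_mul_pred_poissonENat (hfin j₀) fun k => F (Function.update n j₀ k)

lemma lintegral_erase (hΦ : IsPoissonPointProcess P μ Φ) {ι : Type*} [Fintype ι] [DecidableEq ι]
    {B : ι → Set X} (hB : ∀ i, MeasurableSet (B i)) (hfin : ∀ i, μ (B i) ≠ ∞) (i₀ : ι)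
    (F : (ι → ℕ∞) → ℝ≥0∞) :
    ∫⁻ ω, (∫⁻ x in B i₀, F (fun i => ((Φ ω).erase x).count (B i))
        ∂(Config.pointKernel X (Φ ω))) ∂P =
      μ (B i₀) * ∫⁻ ω, F (fun i => (Φ ω).count (B i)) ∂P := by
  have hdisj : Pairwise (Function.onFun Disjoint
      fun S : {S : Finset ι // i₀ ∈ S} => atom B S.1) :=
    fun S T h => disjoint_atom B fun h' => h (Subtype.ext h')
  have hsplit : ∀ (ν : Measure X) (g : X → ℝ≥0∞), ∫⁻ x in B i₀, g x ∂ν =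
      ∑ S : {S : Finset ι // i₀ ∈ S}, ∫⁻ x in atom B S.1, g x ∂ν := fun ν g => by
    rw [← iUnion_atom B i₀, lintegral_iUnion (f := g)
      (fun S : {S : Finset ι // i₀ ∈ S} => measurableSet_atom hB S.1) hdisj, tsum_fintype]
  have hμ : μ (B i₀) = ∑ S : {S : Finset ι // i₀ ∈ S}, μ (atom B S.1) := by
    rw [← iUnion_atom B i₀, measure_iUnion hdisj (fun S => measurableSet_atom hB S.1),
      tsum_fintype]
  have hmeas : Measurable fun p : Config X × X => F (fun i => (p.1.erase p.2).count (B i)) :=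
    (measurable_of_countable F).comp (measurable_pi_lambda _ fun i =>
      (Config.measurable_count (hB i)).comp Config.measurable_erase)
  simp_rw [hsplit]
  rw [lintegral_finsetSum _ fun S _ => ?_, hμ, Finset.sum_mul]
  · refine Finset.sum_congr rfl fun S _ => ?_
    simp_rw [count_eq_atomSum B]
    exact hΦ.lintegral_erase_of_disjoint (C := fun S : {S : Finset ι // S.Nonempty} => atom B S.1)
      (fun S => measurableSet_atom hB S.1)
      (fun S T h => disjoint_atom B fun h' => h (Subtype.ext h')) (measure_atom_ne_top hfin)
      ⟨S.1, ⟨i₀, S.2⟩⟩ fun n => F (atomSum ι n)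
  · have := hmeas.lintegral_kernel_prod_right'
      (κ := (Config.pointKernel X).restrict (measurableSet_atom hB S.1))
    simp only [Kernel.restrict_apply] at this
    exact this.comp hΦ.measurable

/-- The Mecke equation, for product sets. -/
lemma mecke_prod [SigmaFinite μ] (hΦ : IsPoissonPointProcess P μ Φ) {A : Set X}
    (hA : MeasurableSet A) (hμA : μ A ≠ ∞) :
    (((P.map Φ) ⊗ₘ (Config.pointKernel X).restrict hA).map
      fun p : Config X × X => p.1.erase p.2) = μ A • P.map Φ := by
  classical
  have := Measure.isProbabilityMeasure_map (μ := P) hΦ.measurable.aemeasurable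
  have : IsFiniteMeasure (μ A • P.map Φ) := ⟨by simpa using hμA.lt_top⟩
  -- The sides are exchanged because the uniqueness lemma asks for finiteness of its first measure,
  -- known here only for `μ A • P.map Φ`.
  refine (Config.ext_of_map_count μ fun I => ?_).symm
  have hm : Measurable fun (s : Config X) (B : I) => s.count B.1.1 :=
    measurable_pi_lambda _ fun B => Config.measurable_count B.1.2.1
  have key : ∀ F : (I → ℕ∞) → ℝ≥0∞, ∫⁻ ω, (∫⁻ x in A, F (fun B => ((Φ ω).erase x).count B.1.1)
        ∂(Config.pointKernel X (Φ ω))) ∂P =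
      μ A * ∫⁻ ω, F (fun B => (Φ ω).count B.1.1) ∂P := by
    intro F
    -- The domain of integration `A` joins the family of test sets as the index `none`, on which the
    -- test function does not depend.
    let B : Option I → Set X := fun o => o.elim A fun B => B.1.1
    have hB : ∀ o, MeasurableSet (B o) := by
      rintro (_ | B)
      · exact hA
      · exact B.1.2.1
    have hB' : ∀ o, μ (B o) ≠ ∞ := by
      rintro (_ | B)
      · exact hμA
      · exact B.1.2.2
    exact hΦ.lintegral_erase hB hB' none fun n => F fun B => n (some B)
  ext H hH
  have hH1 : Measurable (H.indicator (fun _ => (1 : ℝ≥0∞))) := measurable_one.indicator hH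
  rw [← lintegral_indicator_one hH, ← lintegral_indicator_one hH]
  change ∫⁻ a, H.indicator (fun _ => (1 : ℝ≥0∞)) a ∂_ = ∫⁻ a, H.indicator (fun _ => (1 : ℝ≥0∞)) a ∂_
  rw [lintegral_map hH1 hm, lintegral_map hH1 hm, lintegral_smul_measure,
    lintegral_map (by exact hH1.comp hm) hΦ.measurable,
    lintegral_map (by exact hH1.comp hm) Config.measurable_erase,
    Measure.lintegral_compProd (by exact (hH1.comp hm).comp Config.measurable_erase),
    lintegral_map]
  · simp only [Kernel.restrict_apply]
    exact (key _).symm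
  · exact ((hH1.comp hm).comp Config.measurable_erase).lintegral_kernel_prod_right'
  · exact hΦ.measurable

/-- The Mecke equation for Poisson point processes. -/
theorem mecke [SigmaFinite μ] (hΦ : IsPoissonPointProcess P μ Φ) {f : X × Config X → ℝ≥0∞}
    (hf : Measurable f) :
    ∫⁻ ω, (∫⁻ x, f (x, (Φ ω).erase x) ∂(Config.pointKernel X (Φ ω))) ∂P =
      ∫⁻ x, ∫⁻ ω, f (x, Φ ω) ∂P ∂μ := by
  have := Measure.isProbabilityMeasure_map (μ := P) hΦ.measurable.aemeasurable
  have hg : Measurable fun p : Config X × X => (p.2, p.1.erase p.2) :=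
    measurable_snd.prodMk Config.measurable_erase
  -- The equation is an equality of measures on pairs (point, remaining configuration); rectangles
  -- over sets of finite `μ`-measure determine them.
  have hprod : μ.prod (P.map Φ) = ((P.map Φ) ⊗ₘ (Config.pointKernel X)).map
      fun p : Config X × X => (p.2, p.1.erase p.2) := by
    have hfin : ∀ (A : Set X) (E : Set (Config X)), MeasurableSet A → μ A ≠ ∞ → MeasurableSet E →
        (((P.map Φ) ⊗ₘ (Config.pointKernel X)).map
          fun p : Config X × X => (p.2, p.1.erase p.2)) (A ×ˢ E) = μ A * P.map Φ E := by
      intro A E hA hμA hE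
      have h1 := congrArg (fun ν : Measure (Config X) => ν E) (hΦ.mecke_prod hA hμA)
      simp only [Measure.smul_apply, smul_eq_mul] at h1
      rw [← h1, Measure.map_apply hg (hA.prod hE), Measure.map_apply Config.measurable_erase hE,
        Measure.compProd_apply (hg (hA.prod hE)),
        Measure.compProd_apply (Config.measurable_erase hE)]
      refine lintegral_congr fun s => ?_
      rw [Kernel.restrict_apply, Measure.restrict_apply]
      · congr 1
        ext x
        simp [and_comm]
      · exact measurable_prodMk_left (Config.measurable_erase hE)
    refine Measure.prod_eq_generateFrom (C := {A | MeasurableSet A ∧ μ A ≠ ∞})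
      (D := {E | MeasurableSet E}) ?_ MeasurableSpace.generateFrom_measurableSet ?_
      MeasurableSpace.isPiSystem_measurableSet ?_ ?_ fun A hA E hE => hfin A E hA.1 hA.2 hE
    · refine le_antisymm (MeasurableSpace.generateFrom_le fun A hA => hA.1) fun A hA => ?_
      rw [← Set.inter_univ A, ← iUnion_spanningSets μ, Set.inter_iUnion]
      exact MeasurableSet.iUnion fun n => MeasurableSpace.measurableSet_generateFrom
        ⟨hA.inter (measurableSet_spanningSets μ n),
          ((measure_mono Set.inter_subset_right).trans_lt (measure_spanningSets_lt_top μ n)).ne⟩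
    · rintro A hA B hB -
      exact ⟨hA.1.inter hB.1, ((measure_mono Set.inter_subset_left).trans_lt hA.2.lt_top).ne⟩
    · exact ⟨spanningSets μ, fun n => ⟨measurableSet_spanningSets μ n,
        (measure_spanningSets_lt_top μ n).ne⟩, measure_spanningSets_lt_top μ,
        iUnion_spanningSets μ⟩
    · exact (P.map Φ).toFiniteSpanningSetsIn
  calc ∫⁻ ω, (∫⁻ x, f (x, (Φ ω).erase x) ∂(Config.pointKernel X (Φ ω))) ∂P
      = ∫⁻ s, (∫⁻ x, f (x, s.erase x) ∂(Config.pointKernel X s)) ∂(P.map Φ) := by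
        rw [lintegral_map _ hΦ.measurable]
        exact (hf.comp hg).lintegral_kernel_prod_right'
    _ = ∫⁻ p, f p ∂(μ.prod (P.map Φ)) := by
        rw [hprod, lintegral_map hf hg, Measure.lintegral_compProd (by exact hf.comp hg)]
    _ = _ := by
        rw [lintegral_prod _ hf.aemeasurable]
        refine lintegral_congr fun x => ?_
        rw [lintegral_map (by exact hf.comp measurable_prodMk_left) hΦ.measurable]

lemma measure_count_eq_zero_of_ne_top (hΦ : IsPoissonPointProcess P μ Φ) {A : Set X}
    (hA : MeasurableSet A) (hμA : μ A ≠ ∞) :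
    P {ω | (Φ ω).count A = 0} = ENNReal.ofReal (Real.exp (-(μ A).toReal)) := by
  rw [← poissonENat_zero, poissonENat, ← hΦ.poisson A hA hμA,
    Measure.map_apply (hΦ.measurable_count hA) (measurableSet_singleton _)]
  rfl

/-- By σ-finiteness `A` contains subsets of finite measure exceeding any `n`, so the void
probability is at most `exp (-n)`. -/
lemma measure_count_eq_zero_of_eq_top [SigmaFinite μ] (hΦ : IsPoissonPointProcess P μ Φ)
    {A : Set X} (hA : MeasurableSet A) (hμA : μ A = ∞) : P {ω | (Φ ω).count A = 0} = 0 := by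
  have hlim : Filter.Tendsto (fun n : ℕ => ENNReal.ofReal (Real.exp (-(n : ℝ)))) Filter.atTop
      (nhds 0) := by
    rw [← ENNReal.ofReal_zero]
    exact (ENNReal.continuous_ofReal.tendsto 0).comp
      (Real.tendsto_exp_neg_atTop_nhds_zero.comp tendsto_natCast_atTop_atTop)
  refine le_antisymm (ge_of_tendsto' hlim fun n => ?_) zero_le
  obtain ⟨t, htm, hts, hnt, htop⟩ := Measure.exists_subset_measure_lt_top (r := (n : ℝ≥0∞)) hA
    (hμA ▸ ENNReal.natCast_lt_top n)
  calc P {ω | (Φ ω).count A = 0} ≤ P {ω | (Φ ω).count t = 0} := by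
        refine measure_mono fun ω hω => ?_
        exact le_antisymm ((Set.encard_le_encard (Set.inter_subset_inter_right _ hts)).trans
          (le_of_eq hω)) zero_le
    _ = ENNReal.ofReal (Real.exp (-(μ t).toReal)) :=
        hΦ.measure_count_eq_zero_of_ne_top htm htop.ne
    _ ≤ _ := by
        refine ENNReal.ofReal_le_ofReal (Real.exp_le_exp.2 (neg_le_neg ?_))
        simpa using (ENNReal.toReal_mono htop.ne hnt.le)

end IsPoissonPointProcess

end

/-! ### Shot noise of tame configurations and measurability of the extremal points. -/

section

instance : LocallyCompactSpace Mark := isOpen_Ioi.locallyCompactSpace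

variable {d : ℕ} {h : Loc d → ℝ≥0∞}

lemma continuous_shot (hh : Continuous h) (φ : Loc d × Mark) : Continuous (shot h φ) :=
  (ENNReal.continuous_const_mul ENNReal.ofReal_ne_top).comp (by fun_prop)

lemma continuous_shot_left (hh : Continuous h) (hfin : ∀ x, h x ≠ ∞) (y : Loc d) :
    Continuous fun φ : Loc d × Mark => shot h φ y := by
  refine continuous_iff_continuousAt.2 fun φ => ?_
  have h1 : Continuous fun φ : Loc d × Mark => ENNReal.ofReal (φ.2 : ℝ) :=
    ENNReal.continuous_ofReal.comp (by fun_prop)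
  have h2 : Continuous fun φ : Loc d × Mark => h (y - φ.1) := hh.comp (by fun_prop)
  exact ENNReal.Tendsto.mul h1.continuousAt (Or.inr (hfin _)) h2.continuousAt
    (Or.inr ENNReal.ofReal_ne_top)

lemma shot_ne_top (hfin : ∀ x, h x ≠ ∞) (φ : Loc d × Mark) (y : Loc d) : shot h φ y ≠ ∞ :=
  ENNReal.mul_ne_top ENNReal.ofReal_ne_top (hfin _)

lemma shot_le_shotNoise {s : Config (Loc d × Mark)} {φ : Loc d × Mark} (hφ : φ ∈ s.1)
    (y : Loc d) : shot h φ y ≤ shotNoise h s y :=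
  le_iSup₂_of_le φ hφ le_rfl

lemma lowerSemicontinuous_shotNoise (hh : Continuous h) (s : Config (Loc d × Mark)) :
    LowerSemicontinuous (shotNoise h s) :=
  lowerSemicontinuous_biSup fun φ _ => (continuous_shot hh φ).lowerSemicontinuous

/-- The marked points whose function exceeds `1 / (j + 1)` somewhere on the ball of radius `n`. -/
def highShots (h : Loc d → ℝ≥0∞) (n j : ℕ) : Set (Loc d × Mark) :=
  {φ | ∃ y ∈ Metric.closedBall (0 : Loc d) n, ((j : ℝ≥0∞) + 1)⁻¹ < shot h φ y}

lemma measurableSet_highShots (hh : Continuous h) (hfin : ∀ x, h x ≠ ∞) (n j : ℕ) :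
    MeasurableSet (highShots h n j) := by
  have : highShots h n j = ⋃ y ∈ Metric.closedBall (0 : Loc d) n,
      {φ | ((j : ℝ≥0∞) + 1)⁻¹ < shot h φ y} := by
    ext φ; simp [highShots]
  rw [this]
  exact (isOpen_biUnion fun y _ =>
    isOpen_lt continuous_const (continuous_shot_left hh hfin y)).measurableSet

/-- A configuration is tame if on each ball, only finitely many of the functions of its points
exceed a given positive level. -/
def Tame (h : Loc d → ℝ≥0∞) (s : Config (Loc d × Mark)) : Prop :=
  ∀ n j : ℕ, (s.1 ∩ highShots h n j).Finite

lemma Tame.mono {s t : Config (Loc d × Mark)} (ht : Tame h t) (hst : s.1 ⊆ t.1) : Tame h s :=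
  fun n j => (ht n j).subset (Set.inter_subset_inter_left _ hst)

lemma exists_inv_succ_lt {c : ℝ≥0∞} (hc : 0 < c) : ∃ j : ℕ, ((j : ℝ≥0∞) + 1)⁻¹ < c := by
  obtain ⟨n, hn⟩ := ENNReal.exists_inv_nat_lt hc.ne'
  exact ⟨n, lt_of_le_of_lt (ENNReal.inv_le_inv.2 le_self_add) hn⟩

/-- Near `y₀` only the finitely many points of some `highShots h n j` can rise above the level `c'`,
so locally the supremum behaves like a finite maximum of continuous functions. -/
lemma Tame.upperSemicontinuous_shotNoise (hh : Continuous h) {s : Config (Loc d × Mark)}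
    (hs : Tame h s) : UpperSemicontinuous (shotNoise h s) := by
  intro y₀ c hc
  obtain ⟨c', hc'1, hc'2⟩ := exists_between hc
  obtain ⟨j, hj⟩ := exists_inv_succ_lt (lt_of_le_of_lt zero_le hc'1)
  obtain ⟨n, hn⟩ := exists_nat_gt ‖y₀‖
  have h1 : ∀ᶠ y in nhds y₀, ∀ φ ∈ s.1 ∩ highShots h n j, shot h φ y < c' :=
    (hs n j).eventually_all.2 fun φ hφ =>
      (continuous_shot hh φ).continuousAt.eventually_lt continuousAt_const
        ((shot_le_shotNoise hφ.1 y₀).trans_lt hc'1)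
  have h2 : ∀ᶠ y in nhds y₀, y ∈ Metric.closedBall (0 : Loc d) n :=
    Metric.closedBall_mem_nhds_of_mem (by simpa using hn)
  filter_upwards [h1, h2] with y hy1 hy2
  refine lt_of_le_of_lt (iSup₂_le fun φ hφ => ?_) hc'2
  by_cases hφ' : φ ∈ highShots h n j
  · exact (hy1 φ ⟨hφ, hφ'⟩).le
  · by_contra hcon
    exact hφ' ⟨y, hy2, hj.trans (not_le.1 hcon)⟩

/-- A countable description of the pairs `(φ, s)` such that the function of `φ` is at least the
extremal shot noise of `s` somewhere. -/
def touchSet (h : Loc d → ℝ≥0∞) : Set ((Loc d × Mark) × Config (Loc d × Mark)) :=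
  {p | ∃ n : ℕ, ∀ k : ℕ, ∃ i : ℕ, TopologicalSpace.denseSeq (Loc d) i ∈ Metric.closedBall 0 n ∧
    shotNoise h p.2 (TopologicalSpace.denseSeq (Loc d) i) <
      shot h p.1 (TopologicalSpace.denseSeq (Loc d) i) + ((k : ℝ≥0∞) + 1)⁻¹}

/-- A countable description of the pairs `(φ, s)` such that the function of `φ` exceeds the
extremal shot noise of `s` somewhere. -/
def exceedSet (h : Loc d → ℝ≥0∞) : Set ((Loc d × Mark) × Config (Loc d × Mark)) :=
  {p | ∃ i : ℕ, shotNoise h p.2 (TopologicalSpace.denseSeq (Loc d) i) <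
    shot h p.1 (TopologicalSpace.denseSeq (Loc d) i)}

/-- The supremum exceeds `a` exactly when the configuration has a point in an open set of marked
points. -/
lemma measurable_shotNoise (hh : Continuous h) (hfin : ∀ x, h x ≠ ∞) (y : Loc d) :
    Measurable fun s => shotNoise h s y := by
  refine measurable_of_Ioi fun a => ?_
  have hm : MeasurableSet {φ : Loc d × Mark | a < shot h φ y} :=
    (isOpen_lt continuous_const (continuous_shot_left hh hfin y)).measurableSet
  have : (fun s => shotNoise h s y) ⁻¹' Set.Ioi a =
      {s | s.count {φ : Loc d × Mark | a < shot h φ y} = 0}ᶜ := by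
    ext s
    simp only [shotNoise, Set.mem_preimage, Set.mem_Ioi, lt_iSup_iff, Config.count,
      Set.mem_compl_iff, Set.mem_ofPred_eq, Set.encard_eq_zero, ← Set.nonempty_iff_ne_empty]
    simp [Set.Nonempty]
  rw [this]
  exact (Config.measurable_count hm (measurableSet_singleton _)).compl

lemma measurable_shotNoise_prod (hh : Continuous h) (hfin : ∀ x, h x ≠ ∞) (y : Loc d) :
    Measurable fun p : (Loc d × Mark) × Config (Loc d × Mark) => shotNoise h p.2 y :=
  (measurable_shotNoise hh hfin y).comp measurable_snd

lemma measurable_shot_prod (hh : Continuous h) (hfin : ∀ x, h x ≠ ∞) (y : Loc d) :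
    Measurable fun p : (Loc d × Mark) × Config (Loc d × Mark) => shot h p.1 y :=
  (continuous_shot_left hh hfin y).measurable.comp measurable_fst

lemma measurableSet_touchSet (hh : Continuous h) (hfin : ∀ x, h x ≠ ∞) :
    MeasurableSet (touchSet h) := by
  have hM := measurable_shotNoise_prod hh hfin
  have hS := measurable_shot_prod hh hfin
  simp only [touchSet, Set.ofPred_exists, Set.ofPred_forall]
  refine MeasurableSet.iUnion fun n => MeasurableSet.iInter fun k => MeasurableSet.iUnion fun i => ?_
  exact (MeasurableSet.const _).inter (measurableSet_lt (hM _) ((hS _).add_const _))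

lemma measurableSet_exceedSet (hh : Continuous h) (hfin : ∀ x, h x ≠ ∞) :
    MeasurableSet (exceedSet h) := by
  simp only [exceedSet, Set.ofPred_exists]
  exact MeasurableSet.iUnion fun i =>
    measurableSet_lt (measurable_shotNoise_prod hh hfin _) (measurable_shot_prod hh hfin _)

lemma Tame.eventually_lt (hh : Continuous h) {s : Config (Loc d × Mark)} (hs : Tame h s)
    {g : Loc d → ℝ≥0∞} (hg : Continuous g) {y : Loc d} (hy : shotNoise h s y < g y) :
    ∀ᶠ z in nhds y, shotNoise h s z < g z := by
  obtain ⟨c, hc1, hc2⟩ := exists_between hy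
  filter_upwards [hs.upperSemicontinuous_shotNoise hh y c hc1,
    hg.continuousAt.eventually_const_lt hc2] with z h1 h2
  exact h1.trans h2

lemma Tame.mem_exceedSet (hh : Continuous h) {s : Config (Loc d × Mark)} (hs : Tame h s)
    (φ : Loc d × Mark) : (φ, s) ∈ exceedSet h ↔ ∃ y, shotNoise h s y < shot h φ y := by
  refine ⟨fun ⟨i, hi⟩ => ⟨_, hi⟩, fun ⟨y, hy⟩ => ?_⟩
  obtain ⟨U, hU, hUo, hyU⟩ := eventually_nhds_iff.1 (hs.eventually_lt hh (continuous_shot hh φ) hy)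
  obtain ⟨i, hi⟩ := (TopologicalSpace.denseRange_denseSeq (Loc d)).exists_mem_open hUo ⟨y, hyU⟩
  exact ⟨i, hU _ hi⟩

/-- Approximate touching points stay in one compact ball, so they accumulate at a `y`; lower
semicontinuity of the shot noise passes the inequality to `y`. Conversely, upper semicontinuity
moves a touching point to a nearby dense point at an arbitrarily small cost. -/
lemma Tame.mem_touchSet (hh : Continuous h) (hfin : ∀ x, h x ≠ ∞) {s : Config (Loc d × Mark)}
    (hs : Tame h s) (φ : Loc d × Mark) :
    (φ, s) ∈ touchSet h ↔ ∃ y, shotNoise h s y ≤ shot h φ y := by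
  constructor
  · rintro ⟨n, hn⟩
    choose i hi1 hi2 using hn
    obtain ⟨y, -, u, hu, hlim⟩ := (isCompact_closedBall (0 : Loc d) n).tendsto_subseq hi1
    refine ⟨y, le_of_not_gt fun hlt => ?_⟩
    obtain ⟨c, hc1, hc2⟩ := exists_between hlt
    obtain ⟨c', hc'1, hc'2⟩ := exists_between hc1
    have h1 := hlim.eventually (lowerSemicontinuous_shotNoise hh s y c hc2)
    have h2 := hlim.eventually ((continuous_shot hh φ).continuousAt.eventually_lt
      continuousAt_const hc'1)
    obtain ⟨j, hj⟩ := exists_inv_succ_lt (tsub_pos_of_lt hc'2)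
    obtain ⟨k, hk1, hk2, hk3⟩ :=
      (h1.and (h2.and (Filter.eventually_ge_atTop j))).exists
    have hjk : ((u k : ℝ≥0∞) + 1)⁻¹ ≤ ((j : ℝ≥0∞) + 1)⁻¹ := by
      refine ENNReal.inv_le_inv.2 ?_
      gcongr
      exact_mod_cast hk3.trans (hu.id_le k)
    have h3 := hk1.trans (hi2 (u k))
    have h4 : shot h φ (TopologicalSpace.denseSeq (Loc d) (i (u k))) + ((u k : ℝ≥0∞) + 1)⁻¹ ≤
        c' + (c - c') := add_le_add hk2.le (hjk.trans hj.le)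
    rw [add_tsub_cancel_of_le hc'2.le] at h4
    exact absurd (h3.trans_le h4) (lt_irrefl _)
  · rintro ⟨y, hy⟩
    obtain ⟨n, hn⟩ := exists_nat_gt ‖y‖
    refine ⟨n, fun k => ?_⟩
    have h1 : shotNoise h s y < shot h φ y + ((k : ℝ≥0∞) + 1)⁻¹ :=
      hy.trans_lt (ENNReal.lt_add_right (shot_ne_top hfin φ y) (by simp))
    have h2 := hs.eventually_lt hh (g := fun z => shot h φ z + ((k : ℝ≥0∞) + 1)⁻¹)
      ((continuous_shot hh φ).add continuous_const) h1
    have h3 : ∀ᶠ z in nhds y, z ∈ Metric.closedBall (0 : Loc d) n :=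
      Metric.closedBall_mem_nhds_of_mem (by simpa using hn)
    obtain ⟨U, hU, hUo, hyU⟩ := eventually_nhds_iff.1 (h3.and h2)
    obtain ⟨i, hi⟩ := (TopologicalSpace.denseRange_denseSeq (Loc d)).exists_mem_open hUo ⟨y, hyU⟩
    exact ⟨i, hU _ hi⟩

lemma shotNoise_erase_le_iff {s : Config (Loc d × Mark)} (φ : Loc d × Mark) (y : Loc d) :
    shotNoise h (s.erase φ) y ≤ shot h φ y ↔ shotNoise h s y ≤ shot h φ y := by
  simp only [shotNoise, iSup₂_le_iff]
  refine ⟨fun H ψ hψ => ?_, fun H ψ hψ => H ψ hψ.1⟩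
  by_cases hψφ : ψ = φ
  · rw [hψφ]
  · exact H ψ ⟨hψ, hψφ⟩

/-- Extremality becomes a condition on the pair (point, remaining configuration), the form that the
Mecke equation needs. The contribution of `φ` itself never violates the bound by `shot h φ`. -/
lemma Tame.erase_mem_touchSet (hh : Continuous h) (hfin : ∀ x, h x ≠ ∞)
    {s : Config (Loc d × Mark)} (hs : Tame h s) {φ : Loc d × Mark} (hφ : φ ∈ s.1) :
    (φ, s.erase φ) ∈ touchSet h ↔ φ ∈ (extremal h s).1 := by
  rw [(hs.mono (s := s.erase φ) Set.sdiff_subset).mem_touchSet hh hfin]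
  simp only [shotNoise_erase_le_iff]
  exact ⟨fun ⟨y, hy⟩ => ⟨hφ, y, hy.antisymm (shot_le_shotNoise hφ y)⟩,
    fun ⟨_, y, hy⟩ => ⟨y, hy.le⟩⟩

lemma shotNoise_translate (z : Loc d) (s : Config (Loc d × Mark)) (y : Loc d) :
    shotNoise h (s.translate z) y = shotNoise h s (y - z) := by
  simp only [shotNoise, Config.translate, iSup_image, shot]
  refine iSup_congr fun φ => iSup_congr fun _ => ?_
  congr 2
  abel

lemma extremal_translate (z : Loc d) (s : Config (Loc d × Mark)) :
    extremal h (s.translate z) = (extremal h s).translate z := by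
  have hs : ∀ (φ : Loc d × Mark) y, shot h (φ.1 + z, φ.2) y = shot h φ (y - z) := fun φ y => by
    simp only [shot]; congr 2; abel
  refine Subtype.ext (Set.ext fun ψ => ⟨?_, ?_⟩)
  · rintro ⟨⟨φ, hφ, rfl⟩, y, hy⟩
    refine ⟨φ, ⟨hφ, y - z, ?_⟩, rfl⟩
    rw [← shotNoise_translate, hy]
    exact hs φ y
  · rintro ⟨φ, ⟨hφ, y, hy⟩, rfl⟩
    refine ⟨⟨φ, hφ, rfl⟩, y + z, ?_⟩
    rw [shotNoise_translate, add_sub_cancel_right, hy]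
    refine Eq.trans ?_ (hs φ (y + z)).symm
    rw [add_sub_cancel_right]

/-- A measurable version of `extremal`. -/
def extremalMeas (h : Loc d → ℝ≥0∞) (s : Config (Loc d × Mark)) : Config (Loc d × Mark) :=
  ⟨{φ ∈ s.1 | (φ, s.erase φ) ∈ touchSet h}, fun K hK =>
    (s.2 K hK).subset fun _ hφ => ⟨hφ.1.1, hφ.2⟩⟩

lemma Tame.extremalMeas_eq (hh : Continuous h) (hfin : ∀ x, h x ≠ ∞)
    {s : Config (Loc d × Mark)} (hs : Tame h s) : extremalMeas h s = extremal h s :=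
  Subtype.ext (Set.ext fun _ => ⟨fun hφ => (hs.erase_mem_touchSet hh hfin hφ.1).1 hφ.2,
    fun hφ => ⟨hφ.1, (hs.erase_mem_touchSet hh hfin hφ.1).2 hφ⟩⟩)

lemma measurableSet_erase_touchSet (hh : Continuous h) (hfin : ∀ x, h x ≠ ∞) :
    MeasurableSet {p : Config (Loc d × Mark) × (Loc d × Mark) |
      (p.2, p.1.erase p.2) ∈ touchSet h} :=
  (measurable_snd.prodMk Config.measurable_erase) (measurableSet_touchSet hh hfin)

lemma count_extremalMeas (hh : Continuous h) (hfin : ∀ x, h x ≠ ∞) (s : Config (Loc d × Mark))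
    {A : Set (Loc d × Mark)} (hA : MeasurableSet A) :
    ((extremalMeas h s).count A : ℝ≥0∞) =
      ∫⁻ φ, (A ×ˢ Set.univ ∩ touchSet h).indicator (fun _ => (1 : ℝ≥0∞)) (φ, s.erase φ)
        ∂(Config.pointKernel (Loc d × Mark) s) := by
  have hm : MeasurableSet (A ∩ {φ : Loc d × Mark | (φ, s.erase φ) ∈ touchSet h}) :=
    hA.inter (measurable_prodMk_left (measurableSet_erase_touchSet hh hfin))
  have : (fun φ => (A ×ˢ Set.univ ∩ touchSet h).indicator (fun _ => (1 : ℝ≥0∞)) (φ, s.erase φ)) =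
      (A ∩ {φ : Loc d × Mark | (φ, s.erase φ) ∈ touchSet h}).indicator 1 := by
    funext φ
    by_cases h1 : φ ∈ A <;> by_cases h2 : (φ, s.erase φ) ∈ touchSet h <;> simp [h1, h2]
  rw [this, lintegral_indicator_one hm, Config.pointKernel_apply _ hm]
  congr 1
  simp only [Config.count, extremalMeas]
  congr 1
  ext φ
  simp
  tauto

lemma measurable_extremalMeas (hh : Continuous h) (hfin : ∀ x, h x ≠ ∞) :
    Measurable (extremalMeas h) := by
  refine Config.measurable_of_measurable_count fun A hA => ?_
  have h1 : Measurable fun s => ((extremalMeas h s).count A : ℝ≥0∞) := by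
    simp_rw [count_extremalMeas hh hfin _ hA]
    refine Measurable.lintegral_kernel_prod_right'
      (f := fun p : Config (Loc d × Mark) × (Loc d × Mark) =>
        (A ×ˢ Set.univ ∩ touchSet h).indicator (fun _ => (1 : ℝ≥0∞)) (p.2, p.1.erase p.2)) ?_
    exact (measurable_const.indicator ((hA.prod MeasurableSet.univ).inter
      (measurableSet_touchSet hh hfin))).comp (measurable_snd.prodMk Config.measurable_erase)
  exact measurable_of_measurable_toENNReal h1

end

/-! ### The mark measure and intensities of sets of high shots. -/

section

section MarkMeasure

variable {ξ : ℝ}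

instance : SigmaFinite ((volume : Measure ℝ).comap ((↑) : Mark → ℝ)) := by
  refine SigmaFinite.of_map _ (f := ((↑) : Mark → ℝ)) (by fun_prop) ?_
  rw [map_comap_subtype_coe measurableSet_Ioi]
  infer_instance

instance (ξ : ℝ) : SigmaFinite (Gξ ξ) := SigmaFinite.withDensity_ofReal _

lemma Gξ_singleton (ξ : ℝ) (m : Mark) : Gξ ξ {m} = 0 := by
  refine withDensity_absolutelyContinuous _ _ ?_
  rw [(MeasurableEmbedding.subtype_coe measurableSet_Ioi).comap_apply]
  simp

/-- The substitution `t = m ^ (-ξ)` has `|dt/dm| = ξ m ^ (-ξ - 1)`, so it carries `Gξ` to Lebesgue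
measure on the half-line. -/
lemma lintegral_Gξ (hξ : 0 < ξ) {f : ℝ → ℝ≥0∞} (hf : Measurable f) :
    ∫⁻ m : Mark, f ((m : ℝ) ^ (-ξ)) ∂(Gξ ξ) = ∫⁻ t in Set.Ioi 0, f t := by
  have himg : (fun x : ℝ => x ^ (-ξ)) '' Set.Ioi 0 = Set.Ioi 0 := by
    ext t
    constructor
    · rintro ⟨x, hx, rfl⟩
      exact Real.rpow_pos_of_pos hx _
    · intro ht
      refine ⟨t ^ (-ξ)⁻¹, Real.rpow_pos_of_pos ht _, ?_⟩
      simp only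
      rw [← Real.rpow_mul (le_of_lt ht), inv_mul_cancel₀ (by linarith), Real.rpow_one]
  have hinj : Set.InjOn (fun x : ℝ => x ^ (-ξ)) (Set.Ioi 0) :=
    (Real.rpow_left_injOn (neg_ne_zero.2 hξ.ne')).mono Set.Ioi_subset_Ici_self
  have hint := lintegral_image_eq_lintegral_abs_deriv_mul measurableSet_Ioi
    (fun x hx => (Real.hasDerivAt_rpow_const (p := -ξ) (Or.inl (ne_of_gt hx))).hasDerivWithinAt)
    hinj f
  rw [himg] at hint
  rw [hint, ← lintegral_subtype_comap measurableSet_Ioi, Gξ,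
    lintegral_withDensity_eq_lintegral_mul _ (by fun_prop) (by fun_prop)]
  refine lintegral_congr fun m => ?_
  have hm : (0 : ℝ) < m := m.2
  simp only [Pi.mul_apply]
  rw [abs_mul, abs_neg, abs_of_pos hξ, abs_of_pos (Real.rpow_pos_of_pos hm _)]

lemma Gξ_univ (hξ : 0 < ξ) : Gξ ξ Set.univ = ∞ := by
  have := lintegral_Gξ hξ (f := fun _ => 1) measurable_const
  simpa using this

lemma Gξ_Ioi (hξ : 0 < ξ) {a : ℝ} (ha : 0 < a) :
    Gξ ξ {m | a < m} = ENNReal.ofReal (a ^ (-ξ)) := by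
  have hm : MeasurableSet {m : Mark | a < m} := measurableSet_lt measurable_const (by fun_prop)
  have h1 := lintegral_Gξ hξ (f := (Set.Iio (a ^ (-ξ))).indicator 1)
    (measurable_one.indicator measurableSet_Iio)
  rw [lintegral_indicator_one measurableSet_Iio, Measure.restrict_apply measurableSet_Iio,
    Set.inter_comm, Set.Ioi_inter_Iio, Real.volume_Ioo, sub_zero] at h1
  rw [← h1, ← lintegral_indicator_one hm]
  refine lintegral_congr fun m => ?_
  have : (m : ℝ) ^ (-ξ) < a ^ (-ξ) ↔ a < m :=
    Real.rpow_lt_rpow_iff_of_neg m.2 ha (by linarith)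
  simp [Set.indicator, this]

lemma Gξ_lt_mul (hξ : 0 < ξ) {t : ℝ≥0∞} (ht : t ≠ 0) (ht' : t ≠ ∞) (H : ℝ≥0∞) :
    Gξ ξ {m | t < ENNReal.ofReal m * H} = (H / t) ^ ξ := by
  rcases eq_or_ne H 0 with rfl | hH
  · simp [hξ]
  rcases eq_or_ne H ∞ with rfl | hH'
  · have : {m : Mark | t < ENNReal.ofReal m * ∞} = Set.univ := by
      ext m
      have : 0 < (m : ℝ) := m.2
      simp [ENNReal.mul_top, this, ht'.lt_top]
    rw [this, Gξ_univ hξ, ENNReal.top_div_of_ne_top ht', ENNReal.top_rpow_of_pos hξ]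
  have hpos : 0 < t.toReal / H.toReal :=
    div_pos (ENNReal.toReal_pos ht ht') (ENNReal.toReal_pos hH hH')
  have hset : {m : Mark | t < ENNReal.ofReal m * H} = {m : Mark | t.toReal / H.toReal < m} := by
    ext m
    have hm : 0 < (m : ℝ) := m.2
    simp only [Set.mem_ofPred_eq]
    rw [← ENNReal.div_lt_iff (Or.inl hH) (Or.inl hH'), ← ENNReal.toReal_div,
      ENNReal.lt_ofReal_iff_toReal_lt (ENNReal.div_ne_top ht' hH)]
  rw [hset, Gξ_Ioi hξ hpos, Real.rpow_neg hpos.le, ← Real.inv_rpow hpos.le, inv_div,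
    ← ENNReal.toReal_div, ENNReal.toReal_rpow, ENNReal.ofReal_toReal]
  exact ENNReal.rpow_ne_top_of_nonneg hξ.le (ENNReal.div_ne_top hH' ht)

lemma lintegral_exp_neg_Gξ (hξ : 0 < ξ) {a : ℝ} (ha : 0 < a) :
    ∫⁻ m : Mark, ENNReal.ofReal (Real.exp (-(a * (m : ℝ) ^ (-ξ)))) ∂(Gξ ξ) =
      (ENNReal.ofReal a)⁻¹ := by
  rw [lintegral_Gξ hξ (f := fun t => ENNReal.ofReal (Real.exp (-(a * t)))) (by fun_prop)]
  have h1 := integral_exp_mul_Ioi (neg_neg_of_pos ha) 0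
  have h2 := integrableOn_exp_mul_Ioi (neg_neg_of_pos ha) 0
  simp only [← neg_mul]
  rw [← ofReal_integral_eq_lintegral_ofReal h2 (ae_of_all _ fun t => (Real.exp_pos _).le), h1,
    ← ENNReal.ofReal_inv_of_pos ha]
  congr 1
  simp

end MarkMeasure

variable {d : ℕ} {ξ : ℝ} {h : Loc d → ℝ≥0∞}

lemma measurable_hPlus (hh : Continuous h) : Measurable (hPlus h) :=
  (lowerSemicontinuous_biSup fun _ _ =>
    (hh.comp (continuous_id.add continuous_const)).lowerSemicontinuous).measurable

lemma le_hPlus (h : Loc d → ℝ≥0∞) {x y : Loc d} (hxy : ‖x - y‖ ≤ 1) : h x ≤ hPlus h y :=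
  le_iSup₂_of_le (x - y) hxy (by simp)

/-- An infinite value of `h` at `x` would make `hPlus h` infinite on a whole unit ball. -/
lemma ne_top_of_lintegral_hPlus (hξ : 0 < ξ) (hplus : (∫⁻ x, hPlus h x ^ ξ) < ∞) (x : Loc d) :
    h x ≠ ∞ := by
  intro hx
  refine hplus.ne (top_unique ?_)
  calc ∞ = ∫⁻ _ in Metric.ball x 1, ∞ := by
        rw [setLIntegral_const, ENNReal.top_mul (Metric.measure_ball_pos _ _ one_pos).ne']
    _ ≤ ∫⁻ y in Metric.ball x 1, hPlus h y ^ ξ := by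
        refine setLIntegral_mono' measurableSet_ball fun y hy => ?_
        have : hPlus h y = ∞ := top_unique (hx ▸ le_hPlus h (by
          rw [← dist_eq_norm, dist_comm]; exact (Metric.mem_ball.1 hy).le))
        rw [this, ENNReal.top_rpow_of_pos hξ]
    _ ≤ _ := setLIntegral_le_lintegral _ _

lemma measure_lt_mul (hξ : 0 < ξ) {g : Loc d → ℝ≥0∞} (hg : Measurable g) {t : ℝ≥0∞}
    (ht : t ≠ 0) (ht' : t ≠ ∞) (y : Loc d) :
    ((volume : Measure (Loc d)).prod (Gξ ξ)) {φ | t < ENNReal.ofReal φ.2 * g (y - φ.1)} =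
      (∫⁻ x, g x ^ ξ) / t ^ ξ := by
  have hm : MeasurableSet {φ : Loc d × Mark | t < ENNReal.ofReal φ.2 * g (y - φ.1)} :=
    measurableSet_lt measurable_const (by fun_prop)
  rw [Measure.prod_apply hm]
  have : ∀ x : Loc d, Gξ ξ (Prod.mk x ⁻¹' {φ | t < ENNReal.ofReal φ.2 * g (y - φ.1)}) =
      g (y - x) ^ ξ * (t ^ ξ)⁻¹ := fun x => by
    rw [← div_eq_mul_inv, ← ENNReal.div_rpow_of_nonneg _ _ hξ.le, ← Gξ_lt_mul hξ ht ht']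
    rfl
  simp_rw [this]
  rw [lintegral_mul_const _ (by fun_prop), lintegral_sub_left_eq_self (fun x => g x ^ ξ) y,
    div_eq_mul_inv]

/-- Finitely many unit balls cover the ball of radius `n`; on each of them `h` is dominated by
`hPlus h` evaluated from the centre, and the measure is then explicit. -/
lemma measure_highShots_lt_top (hξ : 0 < ξ) (hh : Continuous h)
    (hplus : (∫⁻ x, hPlus h x ^ ξ) < ∞) (n j : ℕ) :
    ((volume : Measure (Loc d)).prod (Gξ ξ)) (highShots h n j) < ∞ := by
  obtain ⟨t, -, htf, ht⟩ := (isCompact_closedBall (0 : Loc d) n).finite_cover_balls one_pos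
  have hsub : highShots h n j ⊆ ⋃ y ∈ t,
      {φ | ((j : ℝ≥0∞) + 1)⁻¹ < ENNReal.ofReal φ.2 * hPlus h (y - φ.1)} := by
    rintro φ ⟨y, hy, hφ⟩
    obtain ⟨z, hz, hyz⟩ := Set.mem_iUnion₂.1 (ht hy)
    refine Set.mem_iUnion₂.2 ⟨z, hz, hφ.trans_le ?_⟩
    refine mul_le_mul_right (le_hPlus h ?_) _
    rw [sub_sub_sub_cancel_right, ← dist_eq_norm]
    exact (Metric.mem_ball.1 hyz).le
  refine (measure_mono hsub).trans_lt ((measure_biUnion_lt_top htf) fun y _ => ?_)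
  rw [measure_lt_mul hξ (measurable_hPlus hh) (by simp) (by simp)]
  refine ENNReal.div_lt_top hplus.ne ?_
  simp [ENNReal.rpow_eq_zero_iff]

end

/-! ### Almost sure properties of the Poisson shot noise, translation invariance, positive
intensity. -/

section

namespace IsPoissonPointProcess

section General

variable {Ω X : Type*} [MeasurableSpace Ω] [TopologicalSpace X] [MeasurableSpace X]
  {P : Measure Ω} {μ : Measure X} {Φ : Ω → Config X}

lemma ae_count_ne_top (hΦ : IsPoissonPointProcess P μ Φ) {A : Set X} (hA : MeasurableSet A)
    (hμA : μ A ≠ ∞) : ∀ᵐ ω ∂P, (Φ ω).count A ≠ ⊤ := by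
  have hm : Measurable fun ω => (Φ ω).count A := (Config.measurable_count hA).comp hΦ.measurable
  have h1 : ∀ᵐ k ∂(P.map fun ω => (Φ ω).count A), k ≠ ⊤ := by
    rw [hΦ.poisson A hA hμA, ae_map_iff (measurable_of_countable _).aemeasurable
      (by exact (measurableSet_singleton (⊤ : ℕ∞)).compl)]
    exact ae_of_all _ fun k => ENat.natCast_ne_top k
  exact ae_of_ae_map hm.aemeasurable h1

end General

variable {Ω : Type*} [MeasurableSpace Ω] {P : Measure Ω} [IsProbabilityMeasure P] {d : ℕ} {ξ : ℝ}
  {h : Loc d → ℝ≥0∞} {Φ : Ω → Config (Loc d × Mark)}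

lemma ae_tame (hΦ : IsPoissonPointProcess P ((volume : Measure (Loc d)).prod (Gξ ξ)) Φ)
    (hξ : 0 < ξ) (hh : Continuous h) (hplus : (∫⁻ x, hPlus h x ^ ξ) < ∞) :
    ∀ᵐ ω ∂P, Tame h (Φ ω) := by
  have hfin := ne_top_of_lintegral_hPlus hξ hplus
  have : ∀ᵐ ω ∂P, ∀ n j : ℕ, (Φ ω).count (highShots h n j) ≠ ⊤ := by
    simp only [ae_all_iff]
    exact fun n j => hΦ.ae_count_ne_top (measurableSet_highShots hh hfin n j)
      (measure_highShots_lt_top hξ hh hplus n j).ne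
  filter_upwards [this] with ω hω n j
  exact Set.encard_ne_top_iff.1 (hω n j)

/-- A continuous function with non-zero integral is bounded below on some ball. -/
lemma exists_ball_lt (hξ : 0 < ξ) (hh : Continuous h)
    (hnorm : (∫⁻ x, h x ^ ξ) = 1) :
    ∃ (x₀ : Loc d) (δ : ℝ) (c : ℝ≥0∞), 0 < δ ∧ δ ≤ 1 ∧ c ≠ 0 ∧ c ≠ ∞ ∧
      ∀ x, ‖x - x₀‖ < δ + δ → c < h x := by
  obtain ⟨x₀, hx₀⟩ : ∃ x, h x ≠ 0 := by
    by_contra! hcon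
    simp [hcon, hξ] at hnorm
  obtain ⟨c, hc0, hc⟩ := exists_between (pos_iff_ne_zero.2 hx₀)
  obtain ⟨ε, hε, hball⟩ := Metric.isOpen_iff.1 (isOpen_lt continuous_const hh) x₀ hc
  -- The bound is needed at distance `δ + δ` since two displacements of size `δ` add up in its uses;
  -- `δ ≤ 1` allows comparison with `hPlus`.
  refine ⟨x₀, min (ε / 2) 1, c, by positivity, min_le_right _ _, hc0.ne',
    (hc.trans_le le_top).ne, fun x hx => hball ?_⟩
  rw [Metric.mem_ball, dist_eq_norm]
  have := min_le_left (ε / 2) 1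
  linarith

/-- A cylinder over any ball has infinite intensity, as `Gξ` does, hence contains a point almost
surely; countably many balls suffice. -/
lemma ae_shotNoise_pos (hΦ : IsPoissonPointProcess P ((volume : Measure (Loc d)).prod (Gξ ξ)) Φ)
    (hξ : 0 < ξ) (hh : Continuous h) (hnorm : (∫⁻ x, h x ^ ξ) = 1) :
    ∀ᵐ ω ∂P, ∀ y, 0 < shotNoise h (Φ ω) y := by
  obtain ⟨x₀, δ, c, hδ, -, -, -, hc⟩ := exists_ball_lt hξ hh hnorm
  have h1 : ∀ᵐ ω ∂P, ∀ i : ℕ, (Φ ω).count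
      (Metric.ball (TopologicalSpace.denseSeq (Loc d) i) δ ×ˢ Set.univ) ≠ 0 := by
    refine ae_all_iff.2 fun i => ?_
    have := hΦ.measure_count_eq_zero_of_eq_top
      (A := Metric.ball (TopologicalSpace.denseSeq (Loc d) i) δ ×ˢ Set.univ)
      (measurableSet_ball.prod MeasurableSet.univ) (by
        rw [Measure.prod_prod, Gξ_univ hξ, ENNReal.mul_top (Metric.measure_ball_pos _ _ hδ).ne'])
    simpa [ae_iff] using this
  filter_upwards [h1] with ω hω y
  obtain ⟨i, hi⟩ := (TopologicalSpace.denseRange_denseSeq (Loc d)).exists_mem_open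
    (Metric.isOpen_ball (x := y - x₀) (ε := δ)) ⟨_, Metric.mem_ball_self hδ⟩
  obtain ⟨φ, hφ, hφi⟩ := Set.encard_ne_zero.1 (hω i)
  refine lt_of_lt_of_le ?_ (shot_le_shotNoise hφ y)
  have h2 : c < h (y - φ.1) := by
    refine hc _ ?_
    have h3 := Metric.mem_ball.1 hi
    have h4 := Metric.mem_ball.1 hφi.1
    calc ‖y - φ.1 - x₀‖ = dist φ.1 (y - x₀) := by
          rw [dist_comm, dist_eq_norm]; congr 1; abel
      _ ≤ _ := dist_triangle _ _ _
      _ < _ := add_lt_add h4 h3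
  have : (0 : ℝ) < φ.2 := φ.2.2
  exact ENNReal.mul_pos (by simpa using this) (zero_le.trans_lt h2).ne'

lemma translate (hΦ : IsPoissonPointProcess P ((volume : Measure (Loc d)).prod (Gξ ξ)) Φ)
    (z : Loc d) : IsPoissonPointProcess P ((volume : Measure (Loc d)).prod (Gξ ξ))
      fun ω => (Φ ω).translate z := by
  have hm : Measurable fun φ : Loc d × Mark => (φ.1 + z, φ.2) := by fun_prop
  have hmp : MeasurePreserving (fun φ : Loc d × Mark => (φ.1 + z, φ.2))
      ((volume : Measure (Loc d)).prod (Gξ ξ)) ((volume : Measure (Loc d)).prod (Gξ ξ)) :=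
    (measurePreserving_add_right volume z).prod (MeasurePreserving.id _)
  refine ⟨(Config.measurable_translate z).comp hΦ.measurable, fun A hA hμA => ?_,
    fun n A hA hdisj => ?_⟩
  · simp_rw [Config.count_translate]
    rw [← hmp.measure_preimage hA.nullMeasurableSet] at hμA ⊢
    exact hΦ.poisson _ (hm hA) hμA
  · simp_rw [Config.count_translate]
    exact hΦ.indep n _ (fun i => hm (hA i)) fun i j hij => (hdisj hij).preimage _

lemma identDistrib_translate
    (hΦ : IsPoissonPointProcess P ((volume : Measure (Loc d)).prod (Gξ ξ)) Φ) (z : Loc d) :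
    IdentDistrib (fun ω => (Φ ω).translate z) Φ P P :=
  ⟨(hΦ.translate z).measurable.aemeasurable, hΦ.measurable.aemeasurable,
    (hΦ.translate z).map_eq_map hΦ⟩

lemma exceedProb_eq (hΦ : IsPoissonPointProcess P ((volume : Measure (Loc d)).prod (Gξ ξ)) Φ)
    (hξ : 0 < ξ) (hh : Continuous h) (hplus : (∫⁻ x, hPlus h x ^ ξ) < ∞) (m : Mark) :
    exceedProb P h Φ m = P {ω | ((0, m), Φ ω) ∈ exceedSet h} := by
  have hfin := ne_top_of_lintegral_hPlus hξ hplus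
  have hm : MeasurableSet {ω | ((0, m), Φ ω) ∈ exceedSet h} :=
    (measurable_const.prodMk hΦ.measurable) (measurableSet_exceedSet hh hfin)
  have h1 : P {ω | ∀ y, ENNReal.ofReal (m : ℝ) * h y ≤ shotNoise h (Φ ω) y} =
      P {ω | ((0, m), Φ ω) ∈ exceedSet h}ᶜ := by
    refine measure_congr ?_
    filter_upwards [hΦ.ae_tame hξ hh hplus] with ω hω
    refine propext ?_
    change (∀ y, ENNReal.ofReal (m : ℝ) * h y ≤ shotNoise h (Φ ω) y) ↔
      ¬ ((0, m), Φ ω) ∈ exceedSet h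
    rw [hω.mem_exceedSet hh]
    simp [shot]
  rw [exceedProb, h1, prob_compl_eq_one_sub hm, ENNReal.sub_sub_cancel (by simp) prob_le_one]

lemma measurable_exceedProb
    (hΦ : IsPoissonPointProcess P ((volume : Measure (Loc d)).prod (Gξ ξ)) Φ)
    (hξ : 0 < ξ) (hh : Continuous h) (hplus : (∫⁻ x, hPlus h x ^ ξ) < ∞) :
    Measurable (exceedProb P h Φ) := by
  have hfin := ne_top_of_lintegral_hPlus hξ hplus
  have : exceedProb P h Φ = fun m => P {ω | ((0, m), Φ ω) ∈ exceedSet h} :=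
    funext fun m => hΦ.exceedProb_eq hξ hh hplus m
  rw [this]
  refine measurable_measure_prodMk_left
    (s := {p : Mark × Ω | (((0 : Loc d), p.1), Φ p.2) ∈ exceedSet h}) ?_
  have h1 : Measurable fun p : Mark × Ω => (((0 : Loc d), p.1), Φ p.2) :=
    (measurable_const.prodMk measurable_fst).prodMk (hΦ.measurable.comp measurable_snd)
  exact h1 (measurableSet_exceedSet hh hfin)

/-- Translating `Φ` by `-φ.1` moves the location to the origin without changing the law. -/
lemma measure_exceedSet (hΦ : IsPoissonPointProcess P ((volume : Measure (Loc d)).prod (Gξ ξ)) Φ)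
    (hξ : 0 < ξ) (hh : Continuous h) (hplus : (∫⁻ x, hPlus h x ^ ξ) < ∞) (φ : Loc d × Mark) :
    P {ω | (φ, Φ ω) ∈ exceedSet h} = exceedProb P h Φ φ.2 := by
  have hfin := ne_top_of_lintegral_hPlus hξ hplus
  have hE : MeasurableSet {s | ((0, φ.2), s) ∈ exceedSet h} :=
    measurable_prodMk_left (measurableSet_exceedSet hh hfin)
  rw [hΦ.exceedProb_eq hξ hh hplus]
  have h1 := (hΦ.identDistrib_translate (-φ.1)).measure_mem_eq hE
  refine Eq.trans ?_ h1
  refine measure_congr ?_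
  filter_upwards [hΦ.ae_tame hξ hh hplus, (hΦ.translate (-φ.1)).ae_tame hξ hh hplus] with ω hω hω'
  refine propext ?_
  change (φ, Φ ω) ∈ exceedSet h ↔ ((0, φ.2), (Φ ω).translate (-φ.1)) ∈ exceedSet h
  rw [hω.mem_exceedSet hh, hω'.mem_exceedSet hh]
  simp only [shotNoise_translate, shot, sub_neg_eq_add, sub_zero]
  constructor
  · rintro ⟨y, hy⟩
    exact ⟨y - φ.1, by simpa using hy⟩
  · rintro ⟨y, hy⟩
    exact ⟨y + φ.1, by simpa using hy⟩

/-- With `c < h x₀`, the points whose function exceeds `m c` at `x₀` have finite intensity `(m c) ^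
(-ξ)`. With positive probability there are none, and then `M` lies below `m h` at `x₀`. -/
lemma exceedProb_pos (hΦ : IsPoissonPointProcess P ((volume : Measure (Loc d)).prod (Gξ ξ)) Φ)
    (hξ : 0 < ξ) (hh : Continuous h) (hnorm : (∫⁻ x, h x ^ ξ) = 1)
    (hplus : (∫⁻ x, hPlus h x ^ ξ) < ∞) (m : Mark) : 0 < exceedProb P h Φ m := by
  have hfin := ne_top_of_lintegral_hPlus hξ hplus
  obtain ⟨x₀, δ, c, hδ, -, hc0, hctop, hc⟩ := exists_ball_lt hξ hh hnorm
  have hx₀ : c < h x₀ := hc _ (by simpa using hδ)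
  have hmpos : (0 : ℝ) < m := m.2
  have hm0 : ENNReal.ofReal (m : ℝ) ≠ 0 := by simpa using hmpos
  have ht0 : ENNReal.ofReal (m : ℝ) * c ≠ 0 := mul_ne_zero hm0 hc0
  have ht1 : ENNReal.ofReal (m : ℝ) * c ≠ ∞ := ENNReal.mul_ne_top ENNReal.ofReal_ne_top hctop
  have hlt : ENNReal.ofReal (m : ℝ) * c < ENNReal.ofReal (m : ℝ) * h x₀ :=
    ENNReal.mul_lt_mul_right hm0 ENNReal.ofReal_ne_top hx₀
  have hμ := measure_lt_mul hξ hh.measurable ht0 ht1 x₀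
  rw [hnorm] at hμ
  have hA : MeasurableSet {φ : Loc d × Mark | ENNReal.ofReal (m : ℝ) * c <
      ENNReal.ofReal φ.2 * h (x₀ - φ.1)} :=
    measurableSet_lt measurable_const (continuous_shot_left hh hfin x₀).measurable
  have hvoid := hΦ.measure_count_eq_zero_of_ne_top hA (by
    rw [hμ]
    refine ENNReal.div_ne_top ENNReal.one_ne_top ?_
    simp [ENNReal.rpow_eq_zero_iff, ht0, ht1])
  rw [hΦ.exceedProb_eq hξ hh hplus]
  refine lt_of_lt_of_le ?_ (hvoid.symm.le.trans (measure_mono_ae ?_))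
  · simpa using Real.exp_pos _
  filter_upwards [hΦ.ae_tame hξ hh hplus] with ω hω hcount
  change ((0, m), Φ ω) ∈ exceedSet h
  rw [hω.mem_exceedSet hh]
  refine ⟨x₀, lt_of_le_of_lt (iSup₂_le fun φ hφ => ?_) (by simpa [shot] using hlt)⟩
  by_contra hcon
  have : φ ∈ (Φ ω).1 ∩ {φ : Loc d × Mark | ENNReal.ofReal (m : ℝ) * c <
      ENNReal.ofReal φ.2 * h (x₀ - φ.1)} := ⟨hφ, not_le.1 hcon⟩
  rw [Set.encard_eq_zero.1 hcount] at this
  exact this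

lemma extremalIntensity_pos
    (hΦ : IsPoissonPointProcess P ((volume : Measure (Loc d)).prod (Gξ ξ)) Φ)
    (hξ : 0 < ξ) (hh : Continuous h) (hnorm : (∫⁻ x, h x ^ ξ) = 1)
    (hplus : (∫⁻ x, hPlus h x ^ ξ) < ∞) : 0 < extremalIntensity P ξ h Φ := by
  rw [extremalIntensity, lintegral_pos_iff_support (hΦ.measurable_exceedProb hξ hh hplus)]
  have : Function.support (exceedProb P h Φ) = Set.univ :=
    Set.eq_univ_of_forall fun m => (hΦ.exceedProb_pos hξ hh hnorm hplus m).ne'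
  rw [this, Gξ_univ hξ]
  simp

end IsPoissonPointProcess

end

/-! ### Finite intensity, the Campbell formula and stationarity of the extremal points. -/

section

namespace IsPoissonPointProcess

variable {Ω : Type*} [MeasurableSpace Ω] {P : Measure Ω} [IsProbabilityMeasure P] {d : ℕ} {ξ : ℝ}
  {h : Loc d → ℝ≥0∞} {Φ : Ω → Config (Loc d × Mark)}

lemma measurableSet_count_eq_zero {X Y : Type*} [TopologicalSpace X] [MeasurableSpace X]
    [T2Space X] [SecondCountableTopology X] [SigmaCompactSpace X] [BorelSpace X]
    [MeasurableSpace Y] {f : Y → Config X} (hf : Measurable f) {W : Set (Y × X)}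
    (hW : MeasurableSet W) : MeasurableSet {y | (f y).count (Prod.mk y ⁻¹' W) = 0} := by
  have h1 : Measurable fun y => (Kernel.comap (Config.pointKernel X) f hf) y (Prod.mk y ⁻¹' W) :=
    Kernel.measurable_kernel_prodMk_left hW
  convert h1 (measurableSet_singleton 0) using 1
  ext y
  simp [Kernel.comap_apply, Config.pointKernel_apply _ (measurable_prodMk_left hW)]

/-- The probability that a cylinder over a ball contains no point with a mark above a level,
integrated over that level. -/
lemma lintegral_void_le (hΦ : IsPoissonPointProcess P ((volume : Measure (Loc d)).prod (Gξ ξ)) Φ)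
    (hξ : 0 < ξ) {c H : ℝ≥0∞} (hc0 : c ≠ 0) (hctop : c ≠ ∞) (hH : H ≠ 0) {δ : ℝ} (hδ : 0 < δ)
    (x : Loc d) :
    ∫⁻ m : Mark, P {ω | (Φ ω).count
        (Metric.ball x δ ×ˢ {m' : Mark | ENNReal.ofReal m * H < ENNReal.ofReal m' * c}) = 0} ∂(Gξ ξ) ≤
      (volume (Metric.ball (0 : Loc d) δ) * c ^ ξ)⁻¹ * H ^ ξ := by
  set v := volume (Metric.ball (0 : Loc d) δ) with hv
  have hv0 : v ≠ 0 := (Metric.measure_ball_pos _ _ hδ).ne'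
  have hvtop : v ≠ ∞ := measure_ball_lt_top.ne
  have hcξ : c ^ ξ ≠ ∞ := ENNReal.rpow_ne_top_of_nonneg hξ.le hctop
  rcases eq_or_ne H ∞ with rfl | hHtop
  · rw [ENNReal.top_rpow_of_pos hξ, ENNReal.mul_top]
    · exact le_top
    · exact ENNReal.inv_ne_zero.2 (ENNReal.mul_ne_top hvtop hcξ)
  have hb0 : v * (c / H) ^ ξ ≠ 0 := by
    refine mul_ne_zero hv0 ?_
    simp [ENNReal.rpow_eq_zero_iff, hc0, hHtop, ENNReal.div_eq_top, hH, hctop]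
  have hbtop : v * (c / H) ^ ξ ≠ ∞ := ENNReal.mul_ne_top hvtop
    (ENNReal.rpow_ne_top_of_nonneg hξ.le (ENNReal.div_ne_top hctop hH))
  -- The intensity of the cylinder is `v (c / H) ^ ξ m ^ (-ξ)`; in the variable `t = m ^ (-ξ)` the
  -- void probability is a pure exponential, whose integral is the inverse of its rate.
  have hprob : ∀ m : Mark, P {ω | (Φ ω).count
      (Metric.ball x δ ×ˢ {m' : Mark | ENNReal.ofReal m * H < ENNReal.ofReal m' * c}) = 0} =
      ENNReal.ofReal (Real.exp (-((v * (c / H) ^ ξ).toReal * (m : ℝ) ^ (-ξ)))) := by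
    intro m
    have hm : (0 : ℝ) < m := m.2
    have hm0 : ENNReal.ofReal (m : ℝ) ≠ 0 := by simpa using hm
    have hμ : ((volume : Measure (Loc d)).prod (Gξ ξ))
        (Metric.ball x δ ×ˢ {m' : Mark | ENNReal.ofReal m * H < ENNReal.ofReal m' * c}) =
        v * (c / H) ^ ξ * ENNReal.ofReal ((m : ℝ) ^ (-ξ)) := by
      rw [Measure.prod_prod, Gξ_lt_mul hξ (mul_ne_zero hm0 hH)
        (ENNReal.mul_ne_top ENNReal.ofReal_ne_top hHtop), Measure.addHaar_ball_center, ← hv,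
        mul_assoc, Real.rpow_neg hm.le, ← Real.inv_rpow hm.le,
        ← ENNReal.ofReal_rpow_of_nonneg (inv_nonneg.2 hm.le) hξ.le,
        ← ENNReal.mul_rpow_of_nonneg _ _ hξ.le, ENNReal.ofReal_inv_of_pos hm, div_eq_mul_inv,
        div_eq_mul_inv, ENNReal.mul_inv (Or.inl hm0) (Or.inl ENNReal.ofReal_ne_top),
        mul_comm (ENNReal.ofReal (m : ℝ))⁻¹, mul_assoc]
    rw [hΦ.measure_count_eq_zero_of_ne_top, hμ, ENNReal.toReal_mul,
      ENNReal.toReal_ofReal (Real.rpow_nonneg hm.le _)]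
    · exact measurableSet_ball.prod (measurableSet_lt measurable_const (by fun_prop))
    · rw [hμ]
      exact ENNReal.mul_ne_top hbtop ENNReal.ofReal_ne_top
  simp_rw [hprob]
  rw [lintegral_exp_neg_Gξ hξ (ENNReal.toReal_pos hb0 hbtop), ENNReal.ofReal_toReal hbtop,
    ENNReal.div_rpow_of_nonneg _ _ hξ.le, div_eq_mul_inv, ← mul_assoc,
    ENNReal.mul_inv (Or.inl (mul_ne_zero hv0 _)) (Or.inl (ENNReal.mul_ne_top hvtop hcξ)), inv_inv]
  simp [ENNReal.rpow_eq_zero_iff, hc0, hctop]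

/-- If `M(y₀) < m h(y₀)`, then for every `y` within `δ` of `y₀` no point lies over the `δ`-ball at
`y - x₀` with a mark `m'` such that `m' c > m h⁺(y)`: its function at `y₀` would exceed `m' c > m
h⁺(y) ≥ m h(y₀)`. So the set of such `y` has volume at least `v`, and taking expectations and
integrating over `m` bounds the intensity by `∫ (h⁺)^ξ / (v² c^ξ)`. -/
lemma extremalIntensity_lt_top
    (hΦ : IsPoissonPointProcess P ((volume : Measure (Loc d)).prod (Gξ ξ)) Φ)
    (hξ : 0 < ξ) (hh : Continuous h) (hnorm : (∫⁻ x, h x ^ ξ) = 1)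
    (hplus : (∫⁻ x, hPlus h x ^ ξ) < ∞) : extremalIntensity P ξ h Φ < ∞ := by
  have hfin := ne_top_of_lintegral_hPlus hξ hplus
  have hPm := measurable_hPlus hh
  obtain ⟨x₀, δ, c, hδ, hδ1, hc0, hctop, hc⟩ := exists_ball_lt hξ hh hnorm
  set v := volume (Metric.ball (0 : Loc d) δ) with hv
  have hv0 : v ≠ 0 := (Metric.measure_ball_pos _ _ hδ).ne'
  let W : Mark → Loc d → Set (Loc d × Mark) := fun m y =>
    Metric.ball (y - x₀) δ ×ˢ {m' : Mark | ENNReal.ofReal m * hPlus h y < ENNReal.ofReal m' * c}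
  -- Where `hPlus h` vanishes the bound to be proved is zero and `lintegral_void_le` does not apply;
  -- these `y` are discarded at no cost, as no exceedance occurs near them.
  let E : Set ((Mark × Loc d) × Ω) :=
    {q | hPlus h q.1.2 ≠ 0 ∧ (Φ q.2).count (W q.1.1 q.1.2) = 0}
  have hE : MeasurableSet E := by
    have h1 : MeasurableSet {q : (Mark × Loc d) × Ω | hPlus h q.1.2 ≠ 0} :=
      (hPm.comp (measurable_snd.comp measurable_fst)) (measurableSet_singleton 0).compl
    have h2 : MeasurableSet {p : ((Mark × Loc d) × Ω) × (Loc d × Mark) |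
        p.2.1 ∈ Metric.ball (p.1.1.2 - x₀) δ ∧
          ENNReal.ofReal p.1.1.1 * hPlus h p.1.1.2 < ENNReal.ofReal p.2.2 * c} :=
      (measurableSet_lt (f := fun p : ((Mark × Loc d) × Ω) × (Loc d × Mark) =>
        dist p.2.1 (p.1.1.2 - x₀)) (by fun_prop) measurable_const).inter
        (measurableSet_lt (f := fun p : ((Mark × Loc d) × Ω) × (Loc d × Mark) =>
          ENNReal.ofReal p.1.1.1 * hPlus h p.1.1.2) (g := fun p => ENNReal.ofReal p.2.2 * c)
          (by fun_prop) (by fun_prop))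
    exact h1.inter (measurableSet_count_eq_zero (hΦ.measurable.comp measurable_snd) h2)
  have hEm : ∀ m, MeasurableSet {p : Loc d × Ω | ((m, p.1), p.2) ∈ E} := fun m =>
    ((measurable_const.prodMk measurable_fst).prodMk measurable_snd :
      Measurable fun p : Loc d × Ω => ((m, p.1), p.2)) hE
  have hA : ∀ m, exceedProb P h Φ m * v ≤ ∫⁻ y, P (Prod.mk (m, y) ⁻¹' E) := by
    intro m
    have hT : MeasurableSet {ω | ((0, m), Φ ω) ∈ exceedSet h} :=
      (measurable_const.prodMk hΦ.measurable) (measurableSet_exceedSet hh hfin)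
    have h1 := Measure.prod_apply (μ := (volume : Measure (Loc d))) (ν := P) (hEm m)
    have h2 := Measure.prod_apply_symm (μ := (volume : Measure (Loc d))) (ν := P) (hEm m)
    refine le_of_le_of_eq ?_ (h2.symm.trans h1)
    rw [hΦ.exceedProb_eq hξ hh hplus, mul_comm, ← lintegral_indicator_const hT]
    refine lintegral_mono (Set.indicator_le fun ω hω => ?_)
    obtain ⟨y₀, hy₀⟩ : ∃ y, shotNoise h (Φ ω) y < ENNReal.ofReal (m : ℝ) * h y := by
      obtain ⟨i, hi⟩ := hω
      exact ⟨_, by simpa [shot] using hi⟩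
    rw [hv, ← Measure.addHaar_ball_center volume y₀]
    refine measure_mono fun y hy => ?_
    have hyy₀ : ‖y₀ - y‖ < δ := by
      rw [← dist_eq_norm, dist_comm]
      exact hy
    have hle : h y₀ ≤ hPlus h y := le_hPlus h (hyy₀.le.trans hδ1)
    refine ⟨fun h0 => ?_, Set.encard_eq_zero.2 (Set.eq_empty_of_forall_notMem ?_)⟩
    · have h0' : hPlus h y = 0 := h0
      rw [h0', nonpos_iff_eq_zero] at hle
      simp [hle] at hy₀
    · rintro φ ⟨hφ, hφ1, hφ2⟩
      have h3 : c < h (y₀ - φ.1) := by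
        refine hc _ ?_
        calc ‖y₀ - φ.1 - x₀‖ = ‖(y₀ - y) - (φ.1 - (y - x₀))‖ := by congr 1; abel
          _ ≤ ‖y₀ - y‖ + ‖φ.1 - (y - x₀)‖ := norm_sub_le _ _
          _ < δ + δ := add_lt_add hyy₀ (by rw [← dist_eq_norm]; exact hφ1)
      have h4 : shotNoise h (Φ ω) y₀ < shotNoise h (Φ ω) y₀ :=
        calc shotNoise h (Φ ω) y₀ < ENNReal.ofReal (m : ℝ) * h y₀ := hy₀
          _ ≤ ENNReal.ofReal (m : ℝ) * hPlus h y := by gcongr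
          _ < ENNReal.ofReal (φ.2 : ℝ) * c := hφ2
          _ ≤ shot h φ y₀ := by unfold shot; gcongr
          _ ≤ shotNoise h (Φ ω) y₀ := shot_le_shotNoise hφ y₀
      exact lt_irrefl _ h4
  have hC : ∀ y, ∫⁻ m, P (Prod.mk (m, y) ⁻¹' E) ∂(Gξ ξ) ≤ (v * c ^ ξ)⁻¹ * hPlus h y ^ ξ := by
    intro y
    rcases eq_or_ne (hPlus h y) 0 with h0 | h0
    · have : ∀ m : Mark, Prod.mk (m, y) ⁻¹' E = ∅ := fun m => by
        ext ω
        simp [E, h0]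
      simp [this]
    · refine le_trans (lintegral_mono fun m => measure_mono fun ω hω => ?_)
        (hΦ.lintegral_void_le hξ hc0 hctop h0 hδ (y - x₀))
      exact hω.2
  have hfinal : extremalIntensity P ξ h Φ * v ≤ (v * c ^ ξ)⁻¹ * ∫⁻ y, hPlus h y ^ ξ := by
    have hsec : Measurable fun q : Mark × Loc d => P (Prod.mk q ⁻¹' E) :=
      measurable_measure_prodMk_left hE
    rw [extremalIntensity, ← lintegral_mul_const _ (hΦ.measurable_exceedProb hξ hh hplus),
      ← lintegral_const_mul _ (by fun_prop)]
    calc ∫⁻ m, exceedProb P h Φ m * v ∂(Gξ ξ)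
        ≤ ∫⁻ m, ∫⁻ y, P (Prod.mk (m, y) ⁻¹' E) ∂volume ∂(Gξ ξ) := lintegral_mono hA
      _ = ∫⁻ y, ∫⁻ m, P (Prod.mk (m, y) ⁻¹' E) ∂(Gξ ξ) ∂volume :=
          lintegral_lintegral_swap hsec.aemeasurable
      _ ≤ _ := lintegral_mono hC
  have hlt : extremalIntensity P ξ h Φ * v < ∞ := by
    refine hfinal.trans_lt (ENNReal.mul_lt_top ?_ hplus)
    refine ENNReal.inv_lt_top.2 (pos_iff_ne_zero.2 (mul_ne_zero hv0 ?_))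
    simp [ENNReal.rpow_eq_zero_iff, hc0, hctop]
  by_contra hcon
  rw [top_unique (not_lt.1 hcon), ENNReal.top_mul hv0] at hlt
  exact lt_irrefl _ hlt

/-- For almost every marked point, touching the extremal shot noise from above is as likely as
exceeding it: given the location, the two events differ for at most one mark. -/
lemma measure_touchSet (hΦ : IsPoissonPointProcess P ((volume : Measure (Loc d)).prod (Gξ ξ)) Φ)
    (hξ : 0 < ξ) (hh : Continuous h) (hnorm : (∫⁻ x, h x ^ ξ) = 1)
    (hplus : (∫⁻ x, hPlus h x ^ ξ) < ∞) :
    ∀ᵐ φ ∂((volume : Measure (Loc d)).prod (Gξ ξ)),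
      P {ω | (φ, Φ ω) ∈ touchSet h} = exceedProb P h Φ φ.2 := by
  have hfin := ne_top_of_lintegral_hPlus hξ hplus
  let N : Set ((Loc d × Mark) × Ω) := {p | (p.1, Φ p.2) ∈ touchSet h \ exceedSet h}
  have hN : MeasurableSet N :=
    (measurable_fst.prodMk (hΦ.measurable.comp measurable_snd) :
      Measurable fun p : (Loc d × Mark) × Ω => (p.1, Φ p.2))
      ((measurableSet_touchSet hh hfin).diff (measurableSet_exceedSet hh hfin))
  have hnull : (((volume : Measure (Loc d)).prod (Gξ ξ)).prod P) N = 0 := by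
    rw [Measure.prod_apply_symm hN, lintegral_eq_zero_iff (measurable_measure_prodMk_right hN)]
    filter_upwards [hΦ.ae_tame hξ hh hplus, hΦ.ae_shotNoise_pos hξ hh hnorm] with ω hω hpos
    change ((volume : Measure (Loc d)).prod (Gξ ξ)) ((fun φ => (φ, ω)) ⁻¹' N) = 0
    have hNω : MeasurableSet ((fun φ => (φ, ω)) ⁻¹' N) := measurable_prodMk_right hN
    rw [Measure.measure_prod_null hNω]
    refine ae_of_all _ fun x => ?_
    change Gξ ξ (Prod.mk x ⁻¹' ((fun φ => (φ, ω)) ⁻¹' N)) = 0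
    have hsub : (Prod.mk x ⁻¹' ((fun φ => (φ, ω)) ⁻¹' N)).Subsingleton := by
      -- At a touching point `M > 0` forces `h (y - x) ≠ 0`, so any larger mark at the same location
      -- exceeds `M` strictly there.
      have key : ∀ m m' : Mark, ((x, m), Φ ω) ∈ touchSet h → ((x, m'), Φ ω) ∉ exceedSet h →
          m' ≤ m := by
        intro m m' hm hm'
        by_contra hlt
        rw [hω.mem_touchSet hh hfin] at hm
        obtain ⟨y, hy⟩ := hm
        refine hm' ((hω.mem_exceedSet hh _).2 ⟨y, hy.trans_lt ?_⟩)
        have h0 : h (y - x) ≠ 0 := by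
          intro h0
          have := (hpos y).trans_le hy
          simp [shot, h0] at this
        refine ENNReal.mul_lt_mul_left h0 (hfin _) ?_
        have hmpos : (0 : ℝ) < m' := m'.2
        exact (ENNReal.ofReal_lt_ofReal_iff hmpos).2 (not_le.1 hlt)
      intro m hm m' hm'
      exact le_antisymm (key _ _ hm'.1 hm.2) (key _ _ hm.1 hm'.2)
    rcases hsub.eq_empty_or_singleton with h0 | ⟨m, h0⟩
    · rw [h0, measure_empty]
    · rw [h0, Gξ_singleton]
  filter_upwards [(Measure.measure_prod_null hN).1 hnull] with φ hφ
  rw [← hΦ.measure_exceedSet hξ hh hplus]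
  have hφ' : ∀ᵐ ω ∂P, (φ, ω) ∉ N := by
    rw [ae_iff]
    simp only [not_not]
    exact hφ
  refine measure_congr ?_
  filter_upwards [hφ', hΦ.ae_tame hξ hh hplus] with ω hω ht
  refine propext ⟨fun h1 => ?_, fun h1 => ?_⟩
  · by_contra h2
    exact hω ⟨h1, h2⟩
  · obtain ⟨y, hy⟩ := (ht.mem_exceedSet hh φ).1 h1
    exact (ht.mem_touchSet hh hfin φ).2 ⟨y, hy.le⟩

lemma campbell_extremal (hΦ : IsPoissonPointProcess P ((volume : Measure (Loc d)).prod (Gξ ξ)) Φ)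
    (hξ : 0 < ξ) (hh : Continuous h) (hnorm : (∫⁻ x, h x ^ ξ) = 1)
    (hplus : (∫⁻ x, hPlus h x ^ ξ) < ∞) {A : Set (Loc d × Mark)} (hA : MeasurableSet A) :
    campbell P (fun ω => extremal h (Φ ω)) A =
      ∫⁻ φ in A, exceedProb P h Φ φ.2 ∂((volume : Measure (Loc d)).prod (Gξ ξ)) := by
  have hfin := ne_top_of_lintegral_hPlus hξ hplus
  have hT := measurableSet_touchSet hh hfin
  calc campbell P (fun ω => extremal h (Φ ω)) A
      = ∫⁻ ω, ((extremalMeas h (Φ ω)).count A : ℝ≥0∞) ∂P := by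
        refine lintegral_congr_ae ?_
        filter_upwards [hΦ.ae_tame hξ hh hplus] with ω hω
        simp only [hω.extremalMeas_eq hh hfin]
    _ = ∫⁻ φ, ∫⁻ ω, (A ×ˢ Set.univ ∩ touchSet h).indicator (fun _ => (1 : ℝ≥0∞)) (φ, Φ ω) ∂P
          ∂((volume : Measure (Loc d)).prod (Gξ ξ)) := by
        simp_rw [count_extremalMeas hh hfin _ hA]
        exact hΦ.mecke (measurable_const.indicator ((hA.prod MeasurableSet.univ).inter hT))
    _ = ∫⁻ φ in A, P {ω | (φ, Φ ω) ∈ touchSet h} ∂((volume : Measure (Loc d)).prod (Gξ ξ)) := by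
        rw [← lintegral_indicator hA]
        refine lintegral_congr fun φ => ?_
        have hTφ : MeasurableSet {ω | (φ, Φ ω) ∈ touchSet h} :=
          (measurable_const.prodMk hΦ.measurable) hT
        by_cases hφ : φ ∈ A
        · rw [Set.indicator_of_mem hφ, ← lintegral_indicator_one hTφ]
          refine lintegral_congr fun ω => ?_
          by_cases h2 : (φ, Φ ω) ∈ touchSet h <;> simp [hφ, h2]
        · simp [hφ]
    _ = _ := setLIntegral_congr_fun_ae hA (by
        filter_upwards [hΦ.measure_touchSet hξ hh hnorm hplus] with φ hφ _ using hφ)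

lemma extremalIntensity_smul_prod
    (hΦ : IsPoissonPointProcess P ((volume : Measure (Loc d)).prod (Gξ ξ)) Φ)
    (hξ : 0 < ξ) (hh : Continuous h) (hnorm : (∫⁻ x, h x ^ ξ) = 1)
    (hplus : (∫⁻ x, hPlus h x ^ ξ) < ∞) {A : Set (Loc d × Mark)} (hA : MeasurableSet A) :
    (extremalIntensity P ξ h Φ •
      (volume : Measure (Loc d)).prod (extremalMarkLaw P ξ h Φ)) A =
      ∫⁻ φ in A, exceedProb P h Φ φ.2 ∂((volume : Measure (Loc d)).prod (Gξ ξ)) := by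
  have h0 := (hΦ.extremalIntensity_pos hξ hh hnorm hplus).ne'
  have htop := (hΦ.extremalIntensity_lt_top hξ hh hnorm hplus).ne
  have hm := hΦ.measurable_exceedProb hξ hh hplus
  have : IsFiniteMeasure ((Gξ ξ).withDensity (exceedProb P h Φ)) := isFiniteMeasure_withDensity htop
  rw [extremalMarkLaw, Measure.prod_smul_right, smul_smul, ENNReal.mul_inv_cancel h0 htop,
    one_smul, prod_withDensity_right hm, withDensity_apply _ hA]

lemma isProbabilityMeasure_extremalMarkLaw
    (hΦ : IsPoissonPointProcess P ((volume : Measure (Loc d)).prod (Gξ ξ)) Φ)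
    (hξ : 0 < ξ) (hh : Continuous h) (hnorm : (∫⁻ x, h x ^ ξ) = 1)
    (hplus : (∫⁻ x, hPlus h x ^ ξ) < ∞) : IsProbabilityMeasure (extremalMarkLaw P ξ h Φ) := by
  refine ⟨?_⟩
  rw [extremalMarkLaw, Measure.smul_apply, withDensity_apply _ MeasurableSet.univ,
    Measure.restrict_univ, smul_eq_mul]
  exact ENNReal.inv_mul_cancel (hΦ.extremalIntensity_pos hξ hh hnorm hplus).ne'
    (hΦ.extremalIntensity_lt_top hξ hh hnorm hplus).ne

/-- Finite Campbell mass above each ball gives almost surely finitely many points there. The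
translated extremal points are the extremal points of a translate of `Φ`, which has the law of `Φ`.
-/
lemma isStationaryMarkedPointProcess_extremal
    (hΦ : IsPoissonPointProcess P ((volume : Measure (Loc d)).prod (Gξ ξ)) Φ)
    (hξ : 0 < ξ) (hh : Continuous h) (hnorm : (∫⁻ x, h x ^ ξ) = 1)
    (hplus : (∫⁻ x, hPlus h x ^ ξ) < ∞) :
    IsStationaryMarkedPointProcess P fun ω => extremal h (Φ ω) := by
  have hfin := ne_top_of_lintegral_hPlus hξ hplus
  have htame := hΦ.ae_tame hξ hh hplus
  have hext : ∀ᵐ ω ∂P, extremalMeas h (Φ ω) = extremal h (Φ ω) :=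
    htame.mono fun ω hω => hω.extremalMeas_eq hh hfin
  have hmeas := (measurable_extremalMeas hh hfin).comp hΦ.measurable
  refine ⟨⟨_, hmeas, hext.mono fun ω hω => hω.symm⟩, ?_, fun z => ?_⟩
  · have h1 : ∀ n : ℕ, ∀ᵐ ω ∂P,
        ((extremalMeas h (Φ ω)).count (Metric.closedBall 0 n ×ˢ Set.univ) : ℝ≥0∞) < ∞ := by
      intro n
      have hB : MeasurableSet (Metric.closedBall (0 : Loc d) n ×ˢ (Set.univ : Set Mark)) :=
        measurableSet_closedBall.prod MeasurableSet.univ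
      refine ae_lt_top ((measurable_of_countable _).comp
        ((Config.measurable_count hB).comp hmeas)) ?_
      have hC : ∫⁻ ω, ((extremalMeas h (Φ ω)).count (Metric.closedBall 0 n ×ˢ Set.univ) : ℝ≥0∞) ∂P =
          campbell P (fun ω => extremal h (Φ ω)) (Metric.closedBall 0 n ×ˢ Set.univ) := by
        refine lintegral_congr_ae ?_
        filter_upwards [hext] with ω hω
        simp only [hω]
      have hprob := hΦ.isProbabilityMeasure_extremalMarkLaw hξ hh hnorm hplus
      rw [hC, hΦ.campbell_extremal hξ hh hnorm hplus hB,
        ← hΦ.extremalIntensity_smul_prod hξ hh hnorm hplus hB, Measure.smul_apply,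
        Measure.prod_prod, measure_univ, mul_one, smul_eq_mul]
      exact ENNReal.mul_ne_top (hΦ.extremalIntensity_lt_top hξ hh hnorm hplus).ne
        measure_closedBall_lt_top.ne
    filter_upwards [ae_all_iff.2 h1, hext] with ω hω heq B hB
    obtain ⟨r, hr⟩ := hB.subset_closedBall 0
    obtain ⟨n, hn⟩ := exists_nat_ge r
    have h2 := hω n
    rw [heq] at h2
    have h3 : (extremal h (Φ ω)).count (Metric.closedBall 0 n ×ˢ Set.univ) < ⊤ := by
      simpa using h2
    exact (Set.encard_lt_top_iff.1 h3).subset (Set.inter_subset_inter_right _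
      (Set.prod_mono (hr.trans (Metric.closedBall_subset_closedBall hn)) le_rfl))
  · have hid := hΦ.identDistrib_translate z
    -- Only `extremalMeas h` is known to be measurable. It agrees with `extremal h` on tame
    -- configurations, and measurability of `Tame h` transfers almost sure tameness from `P` to the
    -- law of `Φ`.
    have hae : AEMeasurable (extremal h) (P.map fun ω => (Φ ω).translate z) := by
      rw [hid.map_eq]
      refine ⟨extremalMeas h, measurable_extremalMeas hh hfin, ?_⟩
      have hset : MeasurableSet {s : Config (Loc d × Mark) | Tame h s} := by
        have : {s : Config (Loc d × Mark) | Tame h s} =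
            ⋂ n : ℕ, ⋂ j : ℕ, {s | s.count (highShots h n j) = ⊤}ᶜ := by
          ext s
          simp [Tame, Config.count, Set.encard_eq_top_iff]
        rw [this]
        exact MeasurableSet.iInter fun n => MeasurableSet.iInter fun j =>
          ((Config.measurable_count (measurableSet_highShots hh hfin n j))
            (measurableSet_singleton _)).compl
      filter_upwards [(ae_map_iff hΦ.measurable.aemeasurable hset).2 htame] with s hs
      exact (hs.extremalMeas_eq hh hfin).symm
    have := hid.comp_of_aemeasurable hae
    simpa only [Function.comp_def, extremal_translate] using this

end IsPoissonPointProcess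

end

end ExtremalShotNoise

end

theorem proposition4p3 {Ω : Type*} [MeasurableSpace Ω] (P : Measure Ω) [IsProbabilityMeasure P]
    (d : ℕ) (ξ : ℝ) (hξ : 0 < ξ)
    (h : ExtremalShotNoise.Loc d → ℝ≥0∞) (hcont : Continuous h)
    (hnorm : (∫⁻ x, h x ^ ξ) = 1)
    (hplus : (∫⁻ x, ExtremalShotNoise.hPlus h x ^ ξ) < ∞)
    (Φ : Ω → ExtremalShotNoise.Config (ExtremalShotNoise.Loc d × ExtremalShotNoise.Mark))
    (hΦ : ExtremalShotNoise.IsPoissonPointProcess P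
      ((volume : Measure (ExtremalShotNoise.Loc d)).prod (ExtremalShotNoise.Gξ ξ)) Φ) :
    ExtremalShotNoise.IsStationaryMarkedPointProcess P
        (fun ω => ExtremalShotNoise.extremal h (Φ ω)) ∧
      0 < ExtremalShotNoise.extremalIntensity P ξ h Φ ∧
      ExtremalShotNoise.extremalIntensity P ξ h Φ < ∞ ∧
      IsProbabilityMeasure (ExtremalShotNoise.extremalMarkLaw P ξ h Φ) ∧
      ∀ A : Set (ExtremalShotNoise.Loc d × ExtremalShotNoise.Mark), MeasurableSet A →
        ExtremalShotNoise.campbell P (fun ω => ExtremalShotNoise.extremal h (Φ ω)) A =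
          (ExtremalShotNoise.extremalIntensity P ξ h Φ •
            (volume : Measure (ExtremalShotNoise.Loc d)).prod
              (ExtremalShotNoise.extremalMarkLaw P ξ h Φ)) A := by
  exact ⟨hΦ.isStationaryMarkedPointProcess_extremal hξ hcont hnorm hplus,
    hΦ.extremalIntensity_pos hξ hcont hnorm hplus,
    hΦ.extremalIntensity_lt_top hξ hcont hnorm hplus,
    hΦ.isProbabilityMeasure_extremalMarkLaw hξ hcont hnorm hplus,
    fun A hA => (hΦ.campbell_extremal hξ hcont hnorm hplus hA).trans
      (hΦ.extremalIntensity_smul_prod hξ hcont hnorm hplus hA).symm⟩
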